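/- Let $n\ge 3$, let $M$ be a compact smooth $n$-dimensional manifold with (possibly empty) boundary $\partial M$, let $g_0$ be a smooth Riemannian metric on $M$, let $m\in[0,\infty)$ and $\phi_0\in C^\infty(M)$, where $\phi_0=0$ if $m=0$. Let $\nu_{g_0}$ be the outward unit normal and $H_{g_0}$ the mean curvature of $\partial M$ (the trace of the second fundamental form with respect to $\nu_{g_0}$), and define the weighted scalar curvature and the weighted mean curvature of the smooth metric measure space $(M,g_0,e^{-\phi_0}dV_{g_0},e^{-\phi_0}dA_{g_0},m)$ by $$R^m_{\phi_0}=R_{g_0}+2\Delta_{g_0}\phi_0-\frac{m+1}{m}|\nabla\phi_0|_{g_0}^2\ \text{ in }M,\qquad H^m_{\phi_0}=H_{g_0}+\frac{\partial\phi_0}{\partial\nu_{g_0}}\ \text{ on }\partial M$$ (so that $R^m_{\phi_0}=R_{g_0}$ if $m=0$). Suppose that $f\in C^\infty(M)$ and $\lambda\in\mathbb R$ make it a gradient weighted Yamabe soliton with boundary, that is, $$\nabla^2 f=(\lambda-R^m_{\phi_0})\,g_0,\quad \langle\nabla f,\nabla\phi_0\rangle=m\,(R^m_{\phi_0}-\lambda)\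 \text{ in }M,\qquad H^m_{\phi_0}=0,\quad \frac{\partial f}{\partial\nu_{g_0}}=0\ \text{ on }\partial M,$$ where $\nabla^2 f$ is the Hessian of $f$ with respect to $g_0$. If in addition $\frac{\partial\phi_0}{\partial\nu_{g_0}}=0$ on $\partial M$, then the weighted scalar curvature is constant in $M$; in fact $R^m_{\phi_0}\equiv\lambda$ on $M$. -/

import Mathlib

open scoped Manifold ContDiff

noncomputable section

/-! ### Riemannian calculus in coordinates

`D` is a subset of `ℝⁿ` with unique derivatives (below always the closed half-space
`{y | 0 ≤ y 0}`, the range of the model with corners), `G` is the matrix of a metric as a function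
of the coordinates, and derivatives are taken within `D`, hence one-sidedly at boundary points. -/
namespace Coord

variable {n : ℕ}

/-- The partial derivative `∂ᵢ F` at `y`, within `D`. -/
def partialDeriv (D : Set (EuclideanSpace ℝ (Fin n))) (i : Fin n)
    (F : EuclideanSpace ℝ (Fin n) → ℝ) (y : EuclideanSpace ℝ (Fin n)) : ℝ :=
  fderivWithin ℝ F D y (EuclideanSpace.single i 1)

/-- The Christoffel symbol `Γᵏᵢⱼ = ½ gᵏˡ (∂ᵢ gⱼₗ + ∂ⱼ gᵢₗ - ∂ₗ gᵢⱼ)`. -/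
def christoffel (D : Set (EuclideanSpace ℝ (Fin n)))
    (G : EuclideanSpace ℝ (Fin n) → Matrix (Fin n) (Fin n) ℝ) (k i j : Fin n)
    (y : EuclideanSpace ℝ (Fin n)) : ℝ :=
  (1 / 2) * ∑ l, (G y)⁻¹ k l *
    (partialDeriv D i (fun z => G z j l) y + partialDeriv D j (fun z => G z i l) y
      - partialDeriv D l (fun z => G z i j) y)

/-- The component `∇²ᵢⱼ F = ∂ᵢ∂ⱼ F - Γᵏᵢⱼ ∂ₖ F` of the Hessian. -/
def hess (D : Set (EuclideanSpace ℝ (Fin n)))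
    (G : EuclideanSpace ℝ (Fin n) → Matrix (Fin n) (Fin n) ℝ)
    (F : EuclideanSpace ℝ (Fin n) → ℝ) (i j : Fin n) (y : EuclideanSpace ℝ (Fin n)) : ℝ :=
  partialDeriv D i (partialDeriv D j F) y
    - ∑ k, christoffel D G k i j y * partialDeriv D k F y

/-- The Laplacian `gⁱʲ ∇²ᵢⱼ F`. -/
def laplacian (D : Set (EuclideanSpace ℝ (Fin n)))
    (G : EuclideanSpace ℝ (Fin n) → Matrix (Fin n) (Fin n) ℝ)
    (F : EuclideanSpace ℝ (Fin n) → ℝ) (y : EuclideanSpace ℝ (Fin n)) : ℝ :=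
  ∑ i, ∑ j, (G y)⁻¹ i j * hess D G F i j y

/-- The inner product of gradients `⟨∇F, ∇F'⟩ = gⁱʲ ∂ᵢF ∂ⱼF'`. -/
def gradInner (D : Set (EuclideanSpace ℝ (Fin n)))
    (G : EuclideanSpace ℝ (Fin n) → Matrix (Fin n) (Fin n) ℝ)
    (F F' : EuclideanSpace ℝ (Fin n) → ℝ) (y : EuclideanSpace ℝ (Fin n)) : ℝ :=
  ∑ i, ∑ j, (G y)⁻¹ i j * partialDeriv D i F y * partialDeriv D j F' y

/-- The component
`Rᵢⱼ = ∂ₖ Γᵏᵢⱼ - ∂ⱼ Γᵏᵢₖ + Γᵏₖₗ Γˡᵢⱼ - Γᵏⱼₗ Γˡᵢₖ` of the Ricci tensor (positive on round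
spheres). -/
def ricci (D : Set (EuclideanSpace ℝ (Fin n)))
    (G : EuclideanSpace ℝ (Fin n) → Matrix (Fin n) (Fin n) ℝ) (i j : Fin n)
    (y : EuclideanSpace ℝ (Fin n)) : ℝ :=
  ∑ k, (partialDeriv D k (christoffel D G k i j) y - partialDeriv D j (christoffel D G k i k) y
    + ∑ l, (christoffel D G k k l y * christoffel D G l i j y
      - christoffel D G k j l y * christoffel D G l i k y))

/-- The scalar curvature `gⁱʲ Rᵢⱼ`. -/
def scalarCurvature (D : Set (EuclideanSpace ℝ (Fin n)))
    (G : EuclideanSpace ℝ (Fin n) → Matrix (Fin n) (Fin n) ℝ)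
    (y : EuclideanSpace ℝ (Fin n)) : ℝ :=
  ∑ i, ∑ j, (G y)⁻¹ i j * ricci D G i j y

/-- The components `νⁱ = -gⁱ⁰ / √g⁰⁰` of the outward unit normal of `{y | 0 ≤ y 0}` at a point with
`y 0 = 0`: the vector of unit length that is orthogonal to `∂ₐ` for `a ≠ 0` and satisfies
`ν⁰ < 0`. -/
def outwardNormal [NeZero n] (G : EuclideanSpace ℝ (Fin n) → Matrix (Fin n) (Fin n) ℝ)
    (y : EuclideanSpace ℝ (Fin n)) (i : Fin n) : ℝ :=
  -((G y)⁻¹ i 0) / Real.sqrt ((G y)⁻¹ 0 0)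

/-- The normal derivative `∂F/∂ν = νⁱ ∂ᵢF`. -/
def normalDeriv [NeZero n] (D : Set (EuclideanSpace ℝ (Fin n)))
    (G : EuclideanSpace ℝ (Fin n) → Matrix (Fin n) (Fin n) ℝ)
    (F : EuclideanSpace ℝ (Fin n) → ℝ) (y : EuclideanSpace ℝ (Fin n)) : ℝ :=
  ∑ i, outwardNormal G y i * partialDeriv D i F y

/-- `-⟨ν, ∇_{∂ᵢ} ∂ⱼ⟩ = -gₖₗ νᵏ Γˡᵢⱼ`. For directions tangent to the boundary this is
the second fundamental form `⟨∇_{∂ᵢ} ν, ∂ⱼ⟩` with respect to the outward normal. -/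
def secondFundamentalForm [NeZero n] (D : Set (EuclideanSpace ℝ (Fin n)))
    (G : EuclideanSpace ℝ (Fin n) → Matrix (Fin n) (Fin n) ℝ) (i j : Fin n)
    (y : EuclideanSpace ℝ (Fin n)) : ℝ :=
  -∑ k, ∑ l, G y k l * outwardNormal G y k * christoffel D G l i j y

/-- The mean curvature: the trace of the second fundamental form over the tangent space of the
boundary. The tensor `gⁱʲ - νⁱνʲ` is the inverse of the metric induced on the boundary; its
components with `i = 0` or `j = 0` vanish. (Positive for round balls.) -/
def meanCurvature [NeZero n] (D : Set (EuclideanSpace ℝ (Fin n)))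
    (G : EuclideanSpace ℝ (Fin n) → Matrix (Fin n) (Fin n) ℝ)
    (y : EuclideanSpace ℝ (Fin n)) : ℝ :=
  ∑ i, ∑ j, ((G y)⁻¹ i j - outwardNormal G y i * outwardNormal G y j)
    * secondFundamentalForm D G i j y

end Coord

/-! ### Riemannian manifolds with boundary -/

section Manifold

variable {n : ℕ} [NeZero n] {M : Type*} [TopologicalSpace M]
  [ChartedSpace (EuclideanHalfSpace n) M] [IsManifold (𝓡∂ n) ∞ M]

variable (n M) in
/-- Smooth Riemannian metrics on a smooth `n`-manifold `M` with (possibly empty) boundary. -/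
abbrev RiemMetric : Type _ :=
  Bundle.ContMDiffRiemannianMetric (𝓡∂ n) ∞ (EuclideanSpace ℝ (Fin n))
    (fun x : M => TangentSpace (𝓡∂ n) x)

namespace RiemMetric

/-- The matrix `gᵢⱼ(y) = g(∂ᵢ, ∂ⱼ)` of the metric in the chart `e`, where `∂ᵢ` is the image of
the `i`-th basis vector under the differential of the inverse of the chart. -/
def gram (g : RiemMetric n M) (e : OpenPartialHomeomorph M (EuclideanHalfSpace n))
    (y : EuclideanSpace ℝ (Fin n)) : Matrix (Fin n) (Fin n) ℝ :=
  Matrix.of fun i j =>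
    g.inner ((e.extend (𝓡∂ n)).symm y)
      (mfderivWithin 𝓘(ℝ, EuclideanSpace ℝ (Fin n)) (𝓡∂ n) (e.extend (𝓡∂ n)).symm
        (Set.range (𝓡∂ n)) y (EuclideanSpace.single i 1))
      (mfderivWithin 𝓘(ℝ, EuclideanSpace ℝ (Fin n)) (𝓡∂ n) (e.extend (𝓡∂ n)).symm
        (Set.range (𝓡∂ n)) y (EuclideanSpace.single j 1))

/-- The `i`-th component `dxⁱ(v)` of a tangent vector `v` at `x`, in the preferred chart at `x`. -/
def coordComponent (x : M) (v : TangentSpace (𝓡∂ n) x) (i : Fin n) : ℝ :=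
  EuclideanSpace.proj (𝕜 := ℝ) i
    (mfderiv (𝓡∂ n) 𝓘(ℝ, EuclideanSpace ℝ (Fin n)) (extChartAt (𝓡∂ n) x) x v)

/-- The Hessian `∇²f` at `x`, as a function of two tangent vectors. -/
def hessian (g : RiemMetric n M) (f : M → ℝ) (x : M) (v w : TangentSpace (𝓡∂ n) x) : ℝ :=
  ∑ i, ∑ j, Coord.hess (Set.range (𝓡∂ n)) (g.gram (chartAt (EuclideanHalfSpace n) x))
      (f ∘ (extChartAt (𝓡∂ n) x).symm) i j (extChartAt (𝓡∂ n) x x)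
    * coordComponent x v i * coordComponent x w j

/-- The Laplace-Beltrami operator `Δ_g f`. -/
def laplacian (g : RiemMetric n M) (f : M → ℝ) (x : M) : ℝ :=
  Coord.laplacian (Set.range (𝓡∂ n)) (g.gram (chartAt (EuclideanHalfSpace n) x))
    (f ∘ (extChartAt (𝓡∂ n) x).symm) (extChartAt (𝓡∂ n) x x)

/-- The function `⟨∇f, ∇h⟩_g`. -/
def gradInner (g : RiemMetric n M) (f h : M → ℝ) (x : M) : ℝ :=
  Coord.gradInner (Set.range (𝓡∂ n)) (g.gram (chartAt (EuclideanHalfSpace n) x))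
    (f ∘ (extChartAt (𝓡∂ n) x).symm) (h ∘ (extChartAt (𝓡∂ n) x).symm) (extChartAt (𝓡∂ n) x x)

/-- The scalar curvature `R_g`. -/
def scalarCurvature (g : RiemMetric n M) (x : M) : ℝ :=
  Coord.scalarCurvature (Set.range (𝓡∂ n)) (g.gram (chartAt (EuclideanHalfSpace n) x))
    (extChartAt (𝓡∂ n) x x)

/-- The outward normal derivative `∂f/∂ν_g` (meaningful at boundary points `x`). -/
def normalDeriv (g : RiemMetric n M) (f : M → ℝ) (x : M) : ℝ :=
  Coord.normalDeriv (Set.range (𝓡∂ n)) (g.gram (chartAt (EuclideanHalfSpace n) x))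
    (f ∘ (extChartAt (𝓡∂ n) x).symm) (extChartAt (𝓡∂ n) x x)

/-- The mean curvature `H_g` of the boundary (meaningful at boundary points `x`). -/
def meanCurvature (g : RiemMetric n M) (x : M) : ℝ :=
  Coord.meanCurvature (Set.range (𝓡∂ n)) (g.gram (chartAt (EuclideanHalfSpace n) x))
    (extChartAt (𝓡∂ n) x x)

end RiemMetric

variable (n M) in
/-- A smooth metric measure space with boundary `(M, g, e^{-φ} dV_g, e^{-φ} dA_g, m)`. The two
measures are determined by `g` and `φ`. -/
structure SmoothMetricMeasureSpace where
  /-- the Riemannian metric `g` -/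
  metric : RiemMetric n M
  /-- the weight function `φ` -/
  phi : M → ℝ
  /-- the dimensional parameter -/
  m : ℝ
  contMDiff_phi : ContMDiff (𝓡∂ n) 𝓘(ℝ, ℝ) ∞ phi
  m_nonneg : 0 ≤ m
  phi_eq_zero : m = 0 → ∀ x, phi x = 0

namespace SmoothMetricMeasureSpace

/-- The weighted scalar curvature `R_φ^m = R_g + 2 Δ_g φ - ((m + 1) / m) |∇φ|²_g`. If `m = 0`, then
`φ = 0`, the last two terms vanish, and this is `R_g`. -/
def weightedScalarCurvature (S : SmoothMetricMeasureSpace n M) (x : M) : ℝ :=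
  S.metric.scalarCurvature x + 2 * S.metric.laplacian S.phi x
    - (S.m + 1) / S.m * S.metric.gradInner S.phi S.phi x

/-- The weighted mean curvature `H_φ^m = H_g + ∂φ/∂ν_g` (meaningful at boundary points `x`). -/
def weightedMeanCurvature (S : SmoothMetricMeasureSpace n M) (x : M) : ℝ :=
  S.metric.meanCurvature x + S.metric.normalDeriv S.phi x

/-- Gradient weighted Yamabe solitons with boundary, with potential function `f` and constant
`lam`. -/
structure IsGradientWeightedYamabeSoliton (S : SmoothMetricMeasureSpace n M) (f : M → ℝ)
    (lam : ℝ) : Prop where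
  contMDiff : ContMDiff (𝓡∂ n) 𝓘(ℝ, ℝ) ∞ f
  hessian_eq : ∀ (x : M) (v w : TangentSpace (𝓡∂ n) x),
    S.metric.hessian f x v w = (lam - S.weightedScalarCurvature x) * S.metric.inner x v w
  gradInner_eq : ∀ x : M,
    S.metric.gradInner f S.phi x = S.m * (S.weightedScalarCurvature x - lam)
  weightedMeanCurvature_eq : ∀ x : M, (𝓡∂ n).IsBoundaryPoint x → S.weightedMeanCurvature x = 0
  normalDeriv_eq : ∀ x : M, (𝓡∂ n).IsBoundaryPoint x → S.metric.normalDeriv f x = 0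

end SmoothMetricMeasureSpace

end Manifold

end

/-! Write `ψ = λ - R`, where `R` is the weighted scalar curvature, and `w = |∇f|²`, and let a prime
denote differentiation along `∇f`. The soliton equation `∇²f = ψ g` says that `∇f` is a conformal
field, and it gives `w' = 2ψw`. Both cases rest on a first-order maximum principle: a smooth
function on the compact `M` attains its maximum, and there its derivative along `∇f` vanishes. This
also holds at boundary points, because `∂f/∂ν = 0` makes `∇f` tangent to `∂M`, so that a two-sided
curve in `M` with velocity `∇f` exists (`exists_curve_gradInner`).

If `m ≠ 0`, then `φ' = -mψ`, so `P = w exp(2φ/m + f)` satisfies `P' = w² exp(2φ/m + f)`. At a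
maximum `w = 0`, hence `P ≡ 0` and `∇f ≡ 0` (`gradInner_self_eq_zero_of_gradInner_eq`). Then `0 =
∇²f = ψ g` gives `ψ = 0`.

If `m = 0`, then `R` is the ordinary scalar curvature. For a conformal gradient field, `R' =
-2(n-1)Δψ - 2ψR` (`gradDeriv_scal`). Since `dw = 2ψ df` is closed, `dψ` and `df` are proportional.
This turns `wΔψ` into `p' + (n-2)ψp`, where `p = ψ'` (`gradInner_mul_lapl`), and leaves an equation
that differentiates only along `∇f` (`gradInner_scal`). For `Q = (n-1)p + (λ/n - ψ/2)w` it reads `Q'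
+ (n-2)ψQ = -((n-2)/2)ψ²w`. The maximum principle for `w^((n-2)/2) (±Q) exp(∓f)` shows `Q = 0` where
`w > 0` (`nonpos_of_gradInner_add_ne_zero`), and since `n > 2` the equation then forces `ψ = 0`
there. Continuity gives `ψ = 0` on the closure of that set, and off the closure `f` is locally
constant, so again `ψ = 0` (`scalarCurvature_eq_of_hessian_eq`).

The tensor calculus is carried out over a commutative `ℝ`-algebra with commuting derivations, then
applied to the smooth functions on a chart domain. As the geometric quantities are defined at each
point in that point's preferred chart, coordinate invariance must be proved before they can be
differentiated. -/

set_option linter.unusedSectionVars false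

noncomputable section

/-! ### Levi-Civita connections and curvature over a ring with commuting derivations -/

namespace AlgRiem

open Matrix

variable {A : Type*} [CommRing A] [Algebra ℝ A] {ι : Type*} [Fintype ι] [DecidableEq ι]

theorem map_deriv_mul (D : Derivation ℝ A A) (M N : Matrix ι ι A) :
    (M * N).map D = M.map D * N + M * N.map D := by
  ext i j
  simp only [map_apply, mul_apply, map_sum, Derivation.leibniz, smul_eq_mul, Matrix.add_apply,
    ← Finset.sum_add_distrib]
  exact Finset.sum_congr rfl fun k _ => by ring

theorem map_deriv_mulVec (D : Derivation ℝ A A) (M : Matrix ι ι A) (v : ι → A) :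
    (fun k => D ((M *ᵥ v) k)) = M.map D *ᵥ v + M *ᵥ fun k => D (v k) := by
  ext i
  simp only [map_apply, mulVec, dotProduct, map_sum, Derivation.leibniz, smul_eq_mul,
    Pi.add_apply, ← Finset.sum_add_distrib]
  exact Finset.sum_congr rfl fun k _ => by ring

theorem map_deriv_add (D : Derivation ℝ A A) (M N : Matrix ι ι A) :
    (M + N).map D = M.map D + N.map D := by
  ext i j; simp

theorem map_deriv_transpose (D : Derivation ℝ A A) (M : Matrix ι ι A) :
    Mᵀ.map D = (M.map D)ᵀ := by
  ext i j; simp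

theorem deriv_dotProduct (D : Derivation ℝ A A) (v w : ι → A) :
    D (v ⬝ᵥ w) = (fun k => D (v k)) ⬝ᵥ w + v ⬝ᵥ fun k => D (w k) := by
  simp only [dotProduct, map_sum, Derivation.leibniz, smul_eq_mul, ← Finset.sum_add_distrib]
  exact Finset.sum_congr rfl fun k _ => by ring

/-- The Christoffel matrices `(Γᵢ)ᵏⱼ`. -/
def chr (d : ι → Derivation ℝ A A) (G Gi : Matrix ι ι A) (i : ι) : Matrix ι ι A :=
  of fun k j => (1 / 2 : ℝ) • ∑ l, Gi k l * (d i (G j l) + d j (G i l) - d l (G i j))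

/-- The curvature matrices of the connection `dᵢ + Γᵢ`. -/
def curv (d : ι → Derivation ℝ A A) (Γ : ι → Matrix ι ι A) (i j : ι) : Matrix ι ι A :=
  (Γ j).map (d i) - (Γ i).map (d j) + Γ i * Γ j - Γ j * Γ i

/-- The Ricci tensor of a connection. -/
def ric (d : ι → Derivation ℝ A A) (Γ : ι → Matrix ι ι A) (i j : ι) : A :=
  ∑ k, curv d Γ k j k i

/-- The scalar curvature. -/
def scal (d : ι → Derivation ℝ A A) (Gi : Matrix ι ι A) (Γ : ι → Matrix ι ι A) : A :=
  ∑ i, ∑ j, Gi i j * ric d Γ i j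

/-- The covariant derivative of a vector field. -/
def cov (d : ι → Derivation ℝ A A) (Γ : ι → Matrix ι ι A) (i : ι) (v : ι → A) : ι → A :=
  (fun k => d i (v k)) + Γ i *ᵥ v

/-- Torsion-free connections compatible with a symmetric bilinear form, for commuting
derivations. -/
structure IsLeviCivita (d : ι → Derivation ℝ A A) (G : Matrix ι ι A)
    (Γ : ι → Matrix ι ι A) : Prop where
  comm : ∀ i j a, d i (d j a) = d j (d i a)
  symm : Gᵀ = G
  torsion : ∀ i j k, Γ i k j = Γ j k i
  compat : ∀ i, G.map (d i) = (Γ i)ᵀ * G + G * Γ i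

variable {d : ι → Derivation ℝ A A} {G Gi : Matrix ι ι A} {Γ : ι → Matrix ι ι A}

theorem symm_apply (hG : Gᵀ = G) (i j : ι) : G i j = G j i := by
  conv_lhs => rw [← hG]
  rfl

theorem mul_chr (hGi : G * Gi = 1) (i j k : ι) :
    (G * chr d G Gi i) k j = (1 / 2 : ℝ) • (d i (G j k) + d j (G i k) - d k (G i j)) := by
  have : (G * chr d G Gi i) k j = (1 / 2 : ℝ) •
      (G *ᵥ (Gi *ᵥ fun l => d i (G j l) + d j (G i l) - d l (G i j))) k := by
    simp only [mul_apply, chr, of_apply, mulVec, dotProduct, Finset.smul_sum]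
    simp only [← Finset.smul_sum, mul_smul_comm]
  rw [this, mulVec_mulVec, hGi, one_mulVec]

theorem isLeviCivita_chr (hd : ∀ i j a, d i (d j a) = d j (d i a)) (hG : Gᵀ = G)
    (hGi : G * Gi = 1) : IsLeviCivita d G (chr d G Gi) where
  comm := hd
  symm := hG
  torsion i j k := by
    simp only [chr, of_apply]
    congr 1
    refine Finset.sum_congr rfl fun l _ => ?_
    rw [symm_apply hG i j]; ring
  compat i := by
    ext j k
    have h : (chr d G Gi i)ᵀ * G = (G * chr d G Gi i)ᵀ := by rw [transpose_mul, hG]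
    rw [h, Matrix.add_apply, transpose_apply, mul_chr hGi, mul_chr hGi, map_apply,
      symm_apply hG k j, symm_apply hG i k, symm_apply hG i j, ← smul_add]
    have : (d i (G j k) + d j (G k i) - d k (G j i)) + (d i (G j k) + d k (G j i) - d j (G k i))
        = (2 : ℝ) • d i (G j k) := by
      rw [two_smul]; ring
    rw [this, smul_smul]; norm_num

theorem curv_antisymm (i j : ι) : curv d Γ i j = -curv d Γ j i := by
  simp only [curv]; abel

/-- The Ricci identity: commuting derivations cancel the second derivatives of `v`, and the cross
terms are symmetric in `i` and `j`. -/
theorem cov_cov_sub (hd : ∀ i j a, d i (d j a) = d j (d i a)) (i j : ι) (v : ι → A) :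
    cov d Γ i (cov d Γ j v) - cov d Γ j (cov d Γ i v) = curv d Γ i j *ᵥ v := by
  have h : ∀ i j, cov d Γ i (cov d Γ j v) = (fun k => d i (d j (v k)))
      + ((Γ j).map (d i) *ᵥ v + Γ j *ᵥ fun k => d i (v k))
      + (Γ i *ᵥ (fun k => d j (v k)) + Γ i *ᵥ (Γ j *ᵥ v)) := by
    intro i j
    rw [← map_deriv_mulVec, ← mulVec_add]
    simp only [cov]
    congr 1
    ext k
    simp
  rw [h, h, curv]
  have : (fun k => d i (d j (v k))) = fun k => d j (d i (v k)) := funext fun k => hd i j _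
  simp only [this, sub_mulVec, add_mulVec, mulVec_mulVec]
  abel

namespace IsLeviCivita

/-- Second derivatives of `G` commute; expanding them by metric compatibility leaves exactly the
curvature terms. -/
theorem curv_skew (h : IsLeviCivita d G Γ) (i j : ι) :
    (curv d Γ i j)ᵀ * G + G * curv d Γ i j = 0 := by
  have key : ∀ i j, (G.map (d j)).map (d i) = ((Γ j).map (d i))ᵀ * G
      + (Γ j)ᵀ * ((Γ i)ᵀ * G + G * Γ i) + (((Γ i)ᵀ * G + G * Γ i) * Γ j
      + G * (Γ j).map (d i)) := by
    intro i j
    conv_lhs => rw [h.compat j]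
    rw [map_deriv_add, map_deriv_mul, map_deriv_mul, map_deriv_transpose, h.compat i]
  have hs : (G.map (d j)).map (d i) = (G.map (d i)).map (d j) := by
    ext k l; exact h.comm i j _
  rw [key, key, ← sub_eq_zero] at hs
  rw [← hs]
  simp only [curv, transpose_add, transpose_sub, transpose_mul]
  noncomm_ring

theorem bianchi (h : IsLeviCivita d G Γ) (i j k l : ι) :
    curv d Γ i j l k + curv d Γ j k l i + curv d Γ k i l j = 0 := by
  simp only [curv, Matrix.add_apply, Matrix.sub_apply, map_apply, mul_apply]
  rw [h.torsion i j l, h.torsion j k l, h.torsion k i l]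
  simp only [h.torsion i j, h.torsion j k, h.torsion k i]
  ring

/-- The curvature tensor with all indices lowered. -/
theorem lowered_skew (h : IsLeviCivita d G Γ) (i j k l : ι) :
    (G * curv d Γ i j) k l = -(G * curv d Γ i j) l k := by
  have := congrFun (congrFun (h.curv_skew i j) l) k
  have e : (curv d Γ i j)ᵀ * G = (G * curv d Γ i j)ᵀ := by rw [transpose_mul, h.symm]
  rw [e, Matrix.add_apply, transpose_apply] at this
  exact eq_neg_of_add_eq_zero_left this

theorem lowered_bianchi (h : IsLeviCivita d G Γ) (i j k l : ι) :
    (G * curv d Γ i j) l k + (G * curv d Γ j k) l i + (G * curv d Γ k i) l j = 0 := by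
  simp only [mul_apply, ← Finset.sum_add_distrib, ← mul_add, h.bianchi, mul_zero,
    Finset.sum_const_zero]

theorem lowered_antisymm (i j k l : ι) :
    (G * curv d Γ i j) k l = -(G * curv d Γ j i) k l := by
  rw [curv_antisymm i j, Matrix.mul_neg, Matrix.neg_apply]

/-- The classical octahedron argument: four cyclic identities combined with skewness in both index
pairs give twice the claim, and 2 is invertible in an `ℝ`-algebra. -/
theorem pair_symm (h : IsLeviCivita d G Γ) (i j k l : ι) :
    (G * curv d Γ i j) l k = (G * curv d Γ k l) j i := by
  have h2 : ∀ a : A, a + a = 0 → a = 0 := fun a ha => by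
    have : (1 / 2 : ℝ) • ((2 : ℝ) • a) = 0 := by rw [two_smul, ha, smul_zero]
    simpa [smul_smul] using this
  refine sub_eq_zero.1 (h2 _ ?_)
  have b1 := h.lowered_bianchi i j k l
  have b2 := h.lowered_bianchi j k l i
  have b3 := h.lowered_bianchi k l i j
  have b4 := h.lowered_bianchi l i j k
  have s := h.lowered_skew
  have t := fun i j k l => lowered_antisymm (d := d) (G := G) (Γ := Γ) i j k l
  linear_combination b1 - b3 + b2 - b4 + s i j k l - s k l i j - s j k l i + s l i k j
    - s k i l j + t k i j l - t l j i k + s j l k i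

end IsLeviCivita

end AlgRiem

/-! ### Invariance under change of coordinates -/

namespace AlgRiem

open Matrix

variable {A : Type*} [CommRing A] [Algebra ℝ A] {ι : Type*} [Fintype ι] [DecidableEq ι]
  {d d' : ι → Derivation ℝ A A} {G Gi G' Gi' J J' : Matrix ι ι A} {Γ Γ' : ι → Matrix ι ι A}

theorem eq_zero_of_add_self {a : A} (ha : a + a = 0) : a = 0 := by
  have : (1 / 2 : ℝ) • ((2 : ℝ) • a) = 0 := by rw [two_smul, ha, smul_zero]
  simpa [smul_smul] using this

/-- The components of the Hessian. -/
def hess (d : ι → Derivation ℝ A A) (Γ : ι → Matrix ι ι A) (f : A) (i j : ι) : A :=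
  d i (d j f) - ∑ k, Γ i k j * d k f

/-- The inner product of two gradients. -/
def gradInner (d : ι → Derivation ℝ A A) (Gi : Matrix ι ι A) (f h : A) : A :=
  ∑ i, ∑ j, Gi i j * d i f * d j h

/-- The metrics `G` and `G'` agree in the frames dual to `d` and `d'`, where `dᵢ = ∑ Jᵃᵢ d'ₐ`. -/
structure IsFrameChange (d d' : ι → Derivation ℝ A A) (G G' J J' : Matrix ι ι A) : Prop where
  deriv_eq : ∀ i f, d i f = ∑ a, J a i * d' a f
  closed : ∀ i j a, d i (J a j) = d j (J a i)
  metric_eq : G = Jᵀ * G' * J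
  inv : J * J' = 1

/-- The connection `Γ'` along the frame dual to `d`. -/
def pull (J : Matrix ι ι A) (Γ' : ι → Matrix ι ι A) (i : ι) : Matrix ι ι A :=
  ∑ b, J b i • Γ' b

theorem pull_apply (i a c : ι) : pull J Γ' i a c = ∑ b, J b i * Γ' b a c := by
  simp [pull, Matrix.sum_apply]

namespace IsFrameChange

theorem pull_compat (h : IsFrameChange d d' G G' J J') (h' : IsLeviCivita d' G' Γ') (i : ι) :
    G'.map (d i) = (pull J Γ' i)ᵀ * G' + G' * pull J Γ' i := by
  have : G'.map (d i) = ∑ b, J b i • G'.map (d' b) := by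
    ext k l; simp [h.deriv_eq, Matrix.sum_apply]
  rw [this]
  simp only [h'.compat, pull, transpose_sum, Finset.sum_mul, Finset.mul_sum, smul_add,
    Finset.sum_add_distrib, transpose_smul, Matrix.smul_mul, Matrix.mul_smul]

/-- The transformation law of Christoffel symbols, by uniqueness of the Levi-Civita connection: `P`
is the difference of the two connections with an index lowered. Vanishing torsion makes it symmetric
in one pair of indices and metric compatibility makes it skew in another, so it is zero. -/
theorem mul_connection (h : IsFrameChange d d' G G' J J') (hΓ : IsLeviCivita d G Γ)
    (h' : IsLeviCivita d' G' Γ') (hGi' : G' * Gi' = 1) (i : ι) :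
    J * Γ i = J.map (d i) + pull J Γ' i * J := by
  set U : ι → Matrix ι ι A := fun i => J.map (d i) + pull J Γ' i * J with hU
  set P : ι → Matrix ι ι A := fun i => Jᵀ * G' * U i - G * Γ i with hP
  have hUs : ∀ i j a, U i a j = U j a i := by
    intro i j a
    simp only [hU, Matrix.add_apply, map_apply, h.closed i j, mul_apply, pull_apply,
      Finset.sum_mul]
    congr 1
    rw [Finset.sum_comm]
    refine Finset.sum_congr rfl fun b _ => Finset.sum_congr rfl fun c _ => ?_
    rw [h'.torsion c b]; ring
  have hPs : ∀ i j k, P i k j = P j k i := by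
    intro i j k
    simp only [hP, Matrix.sub_apply, mul_apply, hUs i j, hΓ.torsion i j]
  have hPa : ∀ i, P i + (P i)ᵀ = 0 := by
    intro i
    have e1 := hΓ.compat i
    have e2 : G.map (d i) = (J.map (d i))ᵀ * G' * J
        + Jᵀ * ((pull J Γ' i)ᵀ * G' + G' * pull J Γ' i) * J + Jᵀ * G' * J.map (d i) := by
      conv_lhs => rw [h.metric_eq]
      rw [map_deriv_mul, map_deriv_mul, map_deriv_transpose, h.pull_compat h']
      noncomm_ring
    have e3 : (P i)ᵀ = (J.map (d i))ᵀ * G' * J + Jᵀ * (pull J Γ' i)ᵀ * G' * J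
        - (Γ i)ᵀ * G := by
      simp only [hP, hU, transpose_sub, transpose_mul, transpose_add, transpose_transpose,
        hΓ.symm, h'.symm]
      noncomm_ring
    rw [e3]
    rw [e1, ← sub_eq_zero] at e2
    rw [← neg_eq_zero, ← e2]
    simp only [hP, hU]
    noncomm_ring
  have hPa' : ∀ i j k, P i k j = -P i j k := fun i j k =>
    eq_neg_of_add_eq_zero_left (congrFun (congrFun (hPa i) k) j)
  have hP0 : P i = 0 := by
    ext k j
    refine eq_zero_of_add_self ?_
    linear_combination hPs i j k + hPa' j k i - hPs j k i - hPa' k i j + hPs k i j + hPa' i j k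
  have hPi : Jᵀ * G' * U i = G * Γ i := sub_eq_zero.1 hP0
  have hJt : J'ᵀ * Jᵀ = 1 := by rw [← transpose_mul, h.inv, transpose_one]
  have hGi := mul_eq_one_comm.1 hGi'
  calc J * Γ i = Gi' * (J'ᵀ * (Jᵀ * G' * J * Γ i)) := by
        rw [show J'ᵀ * (Jᵀ * G' * J * Γ i) = (J'ᵀ * Jᵀ) * (G' * (J * Γ i)) by
          noncomm_ring, hJt, one_mul, ← mul_assoc, hGi, one_mul]
    _ = Gi' * (J'ᵀ * (Jᵀ * G' * U i)) := by rw [hPi, ← h.metric_eq]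
    _ = U i := by
        rw [show J'ᵀ * (Jᵀ * G' * U i) = (J'ᵀ * Jᵀ) * (G' * U i) by
          noncomm_ring, hJt, one_mul, ← mul_assoc, hGi, one_mul]

/-- The derivatives of `J` drop out because its rows are closed one-forms; what is left is
tensorial. -/
theorem curv_pull (h : IsFrameChange d d' G G' J J') (i j : ι) :
    curv d (pull J Γ') i j = ∑ b, ∑ c, (J b i * J c j) • curv d' Γ' b c := by
  have h1 : ∀ i j, (pull J Γ' j).map (d i) = ∑ c, d i (J c j) • Γ' c
      + ∑ b, ∑ c, (J b i * J c j) • (Γ' c).map (d' b) := by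
    intro i j
    ext k l
    simp only [map_apply, pull_apply, Matrix.add_apply, Matrix.sum_apply, Matrix.smul_apply,
      smul_eq_mul, map_sum, Derivation.leibniz, Finset.sum_add_distrib]
    rw [add_comm, Finset.sum_comm (s := Finset.univ (α := ι))]
    congr 1
    · exact Finset.sum_congr rfl fun c _ => mul_comm _ _
    · refine Finset.sum_congr rfl fun c _ => ?_
      rw [h.deriv_eq, Finset.mul_sum]
      exact Finset.sum_congr rfl fun b _ => by ring
  have h2 : ∀ i j, pull J Γ' i * pull J Γ' j = ∑ b, ∑ c, (J b i * J c j) • (Γ' b * Γ' c) := by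
    intro i j
    simp only [pull, Finset.sum_mul, Finset.mul_sum, Matrix.smul_mul, Matrix.mul_smul, smul_smul]
    rw [Finset.sum_comm]
    exact Finset.sum_congr rfl fun b _ => Finset.sum_congr rfl fun c _ => by rw [mul_comm]
  have h3 : ∀ i j (F : ι → ι → Matrix ι ι A), ∑ b, ∑ c, (J b j * J c i) • F b c
      = ∑ b, ∑ c, (J b i * J c j) • F c b := by
    intro i j F
    rw [Finset.sum_comm]
    exact Finset.sum_congr rfl fun b _ => Finset.sum_congr rfl fun c _ => by rw [mul_comm]
  rw [curv, h1 i j, h1 j i, h2 i j, h2 j i, h3 i j (fun b c => (Γ' c).map (d' b)),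
    h3 i j (fun b c => Γ' b * Γ' c)]
  simp only [curv, smul_sub, smul_add, Finset.sum_add_distrib, Finset.sum_sub_distrib,
    h.closed i j]
  abel

/-- Gauge covariance of curvature: differentiate `mul_connection` once more and antisymmetrise; the
second derivatives of `J` commute and cancel. -/
theorem mul_curv (h : IsFrameChange d d' G G' J J') (hΓ : IsLeviCivita d G Γ)
    (h' : IsLeviCivita d' G' Γ') (hGi' : G' * Gi' = 1) (i j : ι) :
    J * curv d Γ i j = curv d (pull J Γ') i j * J := by
  have e := h.mul_connection hΓ h' hGi'
  have e1 : ∀ i j, J * (Γ j).map (d i) + J * (Γ i * Γ j) = (J.map (d j)).map (d i)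
      + (pull J Γ' j).map (d i) * J + pull J Γ' j * J.map (d i) + pull J Γ' i * J.map (d j)
      + pull J Γ' i * pull J Γ' j * J := by
    intro i j
    have a := congrArg (fun M : Matrix ι ι A => M.map (d i)) (e j)
    simp only [map_deriv_mul, map_deriv_add] at a
    have b : J * (Γ i * Γ j) = J.map (d i) * Γ j
        + pull J Γ' i * (J.map (d j) + pull J Γ' j * J) := by
      rw [← e j, ← mul_assoc, e i]; noncomm_ring
    have a' : J * (Γ j).map (d i) = (J.map (d j)).map (d i) + ((pull J Γ' j).map (d i) * J
        + pull J Γ' j * J.map (d i)) - J.map (d i) * Γ j := by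
      rw [← a]; abel
    rw [a', b]; noncomm_ring
  have hs : (J.map (d j)).map (d i) = (J.map (d i)).map (d j) := by
    ext k l; exact hΓ.comm i j _
  have e2 : J * curv d Γ i j = (J * (Γ j).map (d i) + J * (Γ i * Γ j))
      - (J * (Γ i).map (d j) + J * (Γ j * Γ i)) := by
    rw [curv]; noncomm_ring
  rw [e2, e1, e1, hs, curv]
  noncomm_ring

theorem inv' (h : IsFrameChange d d' G G' J J') : J' * J = 1 := mul_eq_one_comm.1 h.inv

theorem ric_eq (h : IsFrameChange d d' G G' J J') (hΓ : IsLeviCivita d G Γ)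
    (h' : IsLeviCivita d' G' Γ') (hGi' : G' * Gi' = 1) :
    of (ric d Γ) = Jᵀ * of (ric d' Γ') * J := by
  have e : ∀ i j, curv d Γ i j = J' * (∑ b, ∑ c, (J b i * J c j) • curv d' Γ' b c) * J := by
    intro i j
    rw [← h.curv_pull, mul_assoc, ← h.mul_curv hΓ h' hGi', ← mul_assoc, h.inv', one_mul]
  ext i j
  simp only [of_apply, ric]
  have e2 : ∀ k, curv d Γ k j k i = ∑ b, ∑ a, (J b k * J' k a) *
      ∑ c, ∑ l, J c j * J l i * curv d' Γ' b c a l := by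
    intro k
    rw [e]
    simp only [mul_apply, Matrix.sum_apply, Matrix.smul_apply, smul_eq_mul, Finset.mul_sum,
      Finset.sum_mul]
    rw [Finset.sum_comm]
    refine Finset.sum_congr rfl fun b _ => ?_
    rw [Finset.sum_comm]
    conv_lhs => enter [2, c]; rw [Finset.sum_comm]
    rw [Finset.sum_comm]
    exact Finset.sum_congr rfl fun a _ => Finset.sum_congr rfl fun c _ =>
      Finset.sum_congr rfl fun l _ => by ring
  rw [Finset.sum_congr rfl fun k _ => e2 k, Finset.sum_comm]
  have e3 : ∀ b, ∑ k, ∑ a, (J b k * J' k a) * ∑ c, ∑ l, J c j * J l i * curv d' Γ' b c a l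
      = ∑ c, ∑ l, J c j * J l i * curv d' Γ' b c b l := by
    intro b
    rw [Finset.sum_comm]
    simp only [← Finset.sum_mul]
    have : ∀ a, ∑ k, J b k * J' k a = (1 : Matrix ι ι A) b a := fun a => by
      rw [← h.inv, mul_apply]
    simp [this, one_apply]
  rw [Finset.sum_congr rfl fun b _ => e3 b]
  simp only [mul_apply, transpose_apply, of_apply, Finset.mul_sum, Finset.sum_mul, ric]
  rw [Finset.sum_comm]
  refine Finset.sum_congr rfl fun c _ => ?_
  rw [Finset.sum_comm]
  exact Finset.sum_congr rfl fun l _ => Finset.sum_congr rfl fun b _ => by ring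

theorem metric_inv (h : IsFrameChange d d' G G' J J') (hGi : G * Gi = 1) (hGi' : G' * Gi' = 1) :
    Gi = J' * Gi' * J'ᵀ := by
  have : G * (J' * Gi' * J'ᵀ) = 1 := by
    rw [h.metric_eq, show Jᵀ * G' * J * (J' * Gi' * J'ᵀ) = Jᵀ * (G' * ((J * J') * Gi')) * J'ᵀ by
      noncomm_ring, h.inv, one_mul, hGi', mul_one, ← transpose_mul, h.inv', transpose_one]
  rw [← Matrix.inv_eq_right_inv hGi, Matrix.inv_eq_right_inv this]

theorem scal_eq (h : IsFrameChange d d' G G' J J') (hΓ : IsLeviCivita d G Γ)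
    (h' : IsLeviCivita d' G' Γ') (hGi : G * Gi = 1) (hGi' : G' * Gi' = 1) :
    scal d Gi Γ = scal d' Gi' Γ' := by
  have e : ∀ (d : ι → Derivation ℝ A A) Gi Γ, scal d Gi Γ = trace (Gi * (of (ric d Γ))ᵀ) := by
    intro d Gi Γ
    simp [scal, trace, mul_apply]
  rw [e, e, h.ric_eq hΓ h' hGi', h.metric_inv hGi hGi', transpose_mul, transpose_mul,
    transpose_transpose]
  rw [show J' * Gi' * J'ᵀ * (Jᵀ * ((of (ric d' Γ'))ᵀ * J))
    = J' * (Gi' * ((J'ᵀ * Jᵀ) * ((of (ric d' Γ'))ᵀ * J))) by noncomm_ring, trace_mul_comm,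
    ← transpose_mul, h.inv, transpose_one, one_mul, ← mul_assoc, mul_assoc (_ * _) J, h.inv,
    mul_one]

theorem gradInner_eq (h : IsFrameChange d d' G G' J J') (hGi : G * Gi = 1) (hGi' : G' * Gi' = 1)
    (f k : A) : gradInner d Gi f k = gradInner d' Gi' f k := by
  have e : ∀ (d : ι → Derivation ℝ A A) Gi, gradInner d Gi f k
      = (fun i => d i f) ⬝ᵥ (Gi *ᵥ fun i => d i k) := by
    intro d Gi
    simp only [gradInner, dotProduct, mulVec, Finset.mul_sum]
    exact Finset.sum_congr rfl fun i _ => Finset.sum_congr rfl fun j _ => by ring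
  have e2 : ∀ f, (fun i => d i f) = Jᵀ *ᵥ fun i => d' i f := by
    intro f; ext i; simp [h.deriv_eq, mulVec, dotProduct]
  rw [e, e, e2, e2, h.metric_inv hGi hGi', dotProduct_comm, ← dotProduct_transpose_mulVec]
  rw [transpose_transpose, mulVec_mulVec, mulVec_mulVec]
  congr 2
  rw [show J * (J' * Gi' * J'ᵀ) * Jᵀ = (J * J') * (Gi' * (J'ᵀ * Jᵀ)) by noncomm_ring, h.inv,
    ← transpose_mul, h.inv, transpose_one, one_mul, mul_one]

theorem hess_eq (h : IsFrameChange d d' G G' J J') (hΓ : IsLeviCivita d G Γ)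
    (h' : IsLeviCivita d' G' Γ') (hGi' : G' * Gi' = 1) (f : A) :
    of (hess d Γ f) = Jᵀ * of (hess d' Γ' f) * J := by
  ext i j
  have e1 : d i (d j f) = ∑ a, d i (J a j) * d' a f
      + ∑ b, ∑ a, J b i * J a j * d' b (d' a f) := by
    rw [h.deriv_eq j f, map_sum]
    simp only [Derivation.leibniz, smul_eq_mul, Finset.sum_add_distrib]
    rw [add_comm, Finset.sum_comm (s := Finset.univ (α := ι))]
    congr 1
    · exact Finset.sum_congr rfl fun c _ => mul_comm _ _
    · refine Finset.sum_congr rfl fun c _ => ?_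
      rw [h.deriv_eq, Finset.mul_sum]
      exact Finset.sum_congr rfl fun b _ => by ring
  have e2 : ∑ k, Γ i k j * d k f = ∑ a, d i (J a j) * d' a f
      + ∑ b, ∑ c, J b i * J c j * ∑ a, Γ' b a c * d' a f := by
    have : ∑ k, Γ i k j * d k f = ∑ a, (J * Γ i) a j * d' a f := by
      simp only [h.deriv_eq, mul_apply, Finset.mul_sum, Finset.sum_mul]
      rw [Finset.sum_comm]
      exact Finset.sum_congr rfl fun i _ => Finset.sum_congr rfl fun j _ => by ring
    rw [this, h.mul_connection hΓ h' hGi']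
    simp only [Matrix.add_apply, map_apply, add_mul, Finset.sum_add_distrib, mul_apply,
      pull_apply, Finset.sum_mul, Finset.mul_sum]
    congr 1
    conv_lhs => enter [2, a]; rw [Finset.sum_comm]
    rw [Finset.sum_comm]
    refine Finset.sum_congr rfl fun b _ => ?_
    rw [Finset.sum_comm]
    exact Finset.sum_congr rfl fun i _ => Finset.sum_congr rfl fun j _ => by ring
  simp only [of_apply, hess, e1, e2, mul_apply, transpose_apply, Finset.sum_mul]
  rw [add_sub_add_left_eq_sub, ← Finset.sum_sub_distrib, Finset.sum_comm (γ := ι)]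
  refine Finset.sum_congr rfl fun b _ => ?_
  rw [← Finset.sum_sub_distrib]
  exact Finset.sum_congr rfl fun i _ => by ring

end IsFrameChange

end AlgRiem

/-! ### Conformal gradient fields: Lie derivatives of the connection and the curvature -/

namespace AlgRiem

open Matrix

variable {A : Type*} [CommRing A] [Algebra ℝ A] {ι : Type*} [Fintype ι] [DecidableEq ι]
  {d : ι → Derivation ℝ A A} {G Gi : Matrix ι ι A} {Γ : ι → Matrix ι ι A}

theorem map_deriv_smul (D : Derivation ℝ A A) (a : A) (M : Matrix ι ι A) :
    (a • M).map D = D a • M + a • M.map D := by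
  ext i j
  simp only [map_apply, Matrix.smul_apply, smul_eq_mul, Derivation.leibniz, Matrix.add_apply]
  ring

theorem map_deriv_sum (D : Derivation ℝ A A) (M : ι → Matrix ι ι A) :
    (∑ k, M k).map D = ∑ k, (M k).map D := by
  ext i j
  simp [Matrix.sum_apply]

theorem map_deriv_sub (D : Derivation ℝ A A) (M N : Matrix ι ι A) :
    (M - N).map D = M.map D - N.map D := by
  ext i j; simp

/-- The gradient of `f`. -/
def grad (d : ι → Derivation ℝ A A) (Gi : Matrix ι ι A) (f : A) : ι → A :=
  Gi *ᵥ fun i => d i f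

theorem mulVec_grad (hGi : G * Gi = 1) (f : A) : G *ᵥ grad d Gi f = fun i => d i f := by
  rw [grad, mulVec_mulVec, hGi, one_mulVec]

theorem inv_symm (hG : Gᵀ = G) (hGi : G * Gi = 1) : Giᵀ = Gi := by
  have : G * Giᵀ = 1 := by
    conv_lhs => rw [← hG, ← transpose_mul, mul_eq_one_comm.1 hGi, transpose_one]
  exact (Matrix.inv_eq_right_inv this).symm.trans (Matrix.inv_eq_right_inv hGi)

theorem gradInner_eq_sum_grad (hG : Gᵀ = G) (hGi : G * Gi = 1) (f h : A) :
    gradInner d Gi f h = ∑ k, grad d Gi f k * d k h := by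
  simp only [gradInner, grad, mulVec, dotProduct, Finset.sum_mul]
  rw [Finset.sum_comm]
  refine Finset.sum_congr rfl fun i _ => Finset.sum_congr rfl fun j _ => ?_
  rw [symm_apply (inv_symm hG hGi) j i]

theorem gradInner_comm (hG : Gᵀ = G) (hGi : G * Gi = 1) (f h : A) :
    gradInner d Gi f h = gradInner d Gi h f := by
  simp only [gradInner]
  rw [Finset.sum_comm]
  refine Finset.sum_congr rfl fun i _ => Finset.sum_congr rfl fun j _ => ?_
  rw [symm_apply (inv_symm hG hGi) j i]; ring

/-- Differentiation in the direction of the gradient of `f`. -/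
def gradDeriv (d : ι → Derivation ℝ A A) (Gi : Matrix ι ι A) (f : A) : Derivation ℝ A A :=
  ∑ k, grad d Gi f k • d k

theorem gradDeriv_apply (f a : A) :
    gradDeriv d Gi f a = ∑ k, grad d Gi f k * d k a := by
  have : ∀ s : Finset ι, (∑ k ∈ s, grad d Gi f k • d k) a
      = ∑ k ∈ s, grad d Gi f k * d k a := by
    intro s
    induction s using Finset.induction_on with
    | empty => simp
    | insert i s hi ih => rw [Finset.sum_insert hi, Finset.sum_insert hi, Derivation.add_apply, ih]; rfl
  exact this _

/-- The matrix of partial derivatives of the gradient. -/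
def gradJac (d : ι → Derivation ℝ A A) (Gi : Matrix ι ι A) (f : A) : Matrix ι ι A :=
  of fun a k => d k (grad d Gi f a)

namespace IsLeviCivita

theorem deriv_inner (h : IsLeviCivita d G Γ) (i : ι) (v w : ι → A) :
    d i (v ⬝ᵥ G *ᵥ w) = cov d Γ i v ⬝ᵥ G *ᵥ w + v ⬝ᵥ G *ᵥ cov d Γ i w := by
  rw [deriv_dotProduct, map_deriv_mulVec, h.compat]
  simp only [cov, add_dotProduct, mulVec_add, add_mulVec, dotProduct_add, ← mulVec_mulVec]
  have : v ⬝ᵥ (Γ i)ᵀ *ᵥ G *ᵥ w = Γ i *ᵥ v ⬝ᵥ G *ᵥ w := by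
    rw [dotProduct_transpose_mulVec, dotProduct_comm]
  rw [this]; ring

theorem mulVec_cov_grad (h : IsLeviCivita d G Γ) (hGi : G * Gi = 1) (f : A) (i : ι) :
    G *ᵥ cov d Γ i (grad d Gi f) = hess d Γ f i := by
  have e := map_deriv_mulVec (d i) G (grad d Gi f)
  rw [mulVec_grad hGi, h.compat, add_mulVec, ← mulVec_mulVec, ← mulVec_mulVec,
    mulVec_grad hGi] at e
  rw [cov, mulVec_add]
  ext j
  have ej := congrFun e j
  simp only [Pi.add_apply] at ej ⊢
  have : ((Γ i)ᵀ *ᵥ fun i => d i f) j = ∑ k, Γ i k j * d k f := by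
    simp [mulVec, dotProduct]
  rw [hess, ej, this]; ring

theorem deriv_gradInner_self (h : IsLeviCivita d G Γ) (hGi : G * Gi = 1) (f : A) (i : ι) :
    d i (gradInner d Gi f f) = 2 * ∑ j, hess d Γ f i j * grad d Gi f j := by
  have e : gradInner d Gi f f = grad d Gi f ⬝ᵥ G *ᵥ grad d Gi f := by
    rw [mulVec_grad hGi, gradInner_eq_sum_grad h.symm hGi]; rfl
  have e2 : cov d Γ i (grad d Gi f) ⬝ᵥ G *ᵥ grad d Gi f
      = grad d Gi f ⬝ᵥ G *ᵥ cov d Γ i (grad d Gi f) := by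
    conv_lhs => rw [← h.symm, dotProduct_transpose_mulVec]
  rw [e, h.deriv_inner, e2, h.mulVec_cov_grad hGi, dotProduct_comm]
  simp only [dotProduct]; ring

section Conformal

variable {f ψ : A}

theorem mulVec_injective (hGi : G * Gi = 1) {v w : ι → A} (h : G *ᵥ v = G *ᵥ w) : v = w := by
  have := congrArg (fun u => Gi *ᵥ u) h
  simpa [mulVec_mulVec, mul_eq_one_comm.1 hGi] using this

theorem cov_grad (h : IsLeviCivita d G Γ) (hGi : G * Gi = 1)
    (hf : ∀ i j, hess d Γ f i j = ψ * G i j) (i : ι) :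
    cov d Γ i (grad d Gi f) = Pi.single i ψ := by
  apply mulVec_injective hGi
  rw [h.mulVec_cov_grad hGi]
  ext j
  rw [hf, mulVec_single, symm_apply h.symm]
  simp [mul_comm]

/-- The Ricci identity applied to `∇f`, whose covariant derivative is `ψ` times the identity. -/
theorem curv_mulVec_grad (h : IsLeviCivita d G Γ) (hGi : G * Gi = 1)
    (hf : ∀ i j, hess d Γ f i j = ψ * G i j) (i j : ι) :
    curv d Γ i j *ᵥ grad d Gi f = Pi.single j (d i ψ) - Pi.single i (d j ψ) := by
  rw [← cov_cov_sub h.comm, h.cov_grad hGi hf, h.cov_grad hGi hf]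
  have e : ∀ i j, cov d Γ i (Pi.single j ψ)
      = Pi.single j (d i ψ) + fun k => Γ i k j * ψ := by
    intro i j
    ext k
    simp only [cov, Pi.add_apply, mulVec_single]
    congr 1
    by_cases hk : k = j
    · subst hk; simp
    · simp [hk]
  rw [e, e]
  have : (fun k => Γ i k j * ψ) = fun k => Γ j k i * ψ := funext fun k => by rw [h.torsion]
  rw [this]; abel

/-- Pair symmetry moves `∇f` from the vector that the curvature acts on, where `curv_mulVec_grad`
evaluates it, into the first slot of the curvature two-form. -/
theorem sum_grad_smul_curv (h : IsLeviCivita d G Γ) (hGi : G * Gi = 1)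
    (hf : ∀ i j, hess d Γ f i j = ψ * G i j) (j : ι) :
    ∑ k, grad d Gi f k • curv d Γ k j
      = of fun a k => (if a = j then d k ψ else 0) - G j k * grad d Gi ψ a := by
  have e : G * ∑ k, grad d Gi f k • curv d Γ k j
      = G * of fun a k => (if a = j then d k ψ else 0) - G j k * grad d Gi ψ a := by
    ext l k
    have e1 : (G * ∑ m, grad d Gi f m • curv d Γ m j) l k
        = (G *ᵥ (curv d Γ k l *ᵥ grad d Gi f)) j := by
      rw [mulVec_mulVec]
      simp only [Finset.mul_sum, Matrix.mul_smul, Matrix.sum_apply, Matrix.smul_apply,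
        smul_eq_mul, mulVec, dotProduct]
      exact Finset.sum_congr rfl fun i _ => by rw [h.pair_symm, mul_comm]
    have e2 : (G *ᵥ grad d Gi ψ) l = d l ψ := by rw [mulVec_grad hGi]
    rw [e1, h.curv_mulVec_grad hGi hf, mulVec_sub]
    simp only [mul_apply, of_apply, mul_sub, Finset.sum_sub_distrib, mul_ite, mul_zero,
      Finset.sum_ite_eq', Finset.mem_univ, if_true]
    rw [Pi.sub_apply, mulVec_single, mulVec_single, ← e2, symm_apply h.symm l j]
    simp only [mulVec, dotProduct, Finset.mul_sum, Pi.smul_apply, col_apply,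
      MulOpposite.smul_eq_mul_unop, MulOpposite.unop_op]
    congr 1
    exact Finset.sum_congr rfl fun m _ => by ring
  calc _ = (Gi * G) * ∑ k, grad d Gi f k • curv d Γ k j := by
        rw [mul_eq_one_comm.1 hGi, one_mul]
    _ = (Gi * G) * of fun a k => (if a = j then d k ψ else 0) - G j k * grad d Gi ψ a := by
        rw [mul_assoc, e, mul_assoc]
    _ = _ := by rw [mul_eq_one_comm.1 hGi, one_mul]

theorem sum_grad_smul_connection (h : IsLeviCivita d G Γ) (hGi : G * Gi = 1)
    (hf : ∀ i j, hess d Γ f i j = ψ * G i j) :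
    ∑ k, grad d Gi f k • Γ k = ψ • 1 - gradJac d Gi f := by
  ext a i
  have := congrFun (h.cov_grad hGi hf i) a
  simp only [cov, Pi.add_apply, mulVec, dotProduct] at this
  simp only [Matrix.sum_apply, Matrix.smul_apply, smul_eq_mul, Matrix.sub_apply, gradJac,
    of_apply, one_apply, mul_ite, mul_one, mul_zero]
  rw [Pi.single_apply] at this
  rw [← this, add_sub_cancel_left]
  exact Finset.sum_congr rfl fun k _ => by rw [h.torsion k i, mul_comm]

theorem map_gradDeriv (M : Matrix ι ι A) :
    M.map (gradDeriv d Gi f) = ∑ k, grad d Gi f k • M.map (d k) := by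
  ext i j
  simp [gradDeriv_apply, Matrix.sum_apply]

/-- This is `L_X Γ = R(X, ·) + ∇∇X` for `X = ∇f`, where `∇∇X = dψ ⊗ 1`. The terms containing
`gradJac` are the coordinate difference between the Lie derivative and the derivative of components
along `X`. -/
theorem gradDeriv_connection (h : IsLeviCivita d G Γ) (hGi : G * Gi = 1)
    (hf : ∀ i j, hess d Γ f i j = ψ * G i j) (j : ι) :
    (Γ j).map (gradDeriv d Gi f) = ∑ k, grad d Gi f k • curv d Γ k j + d j ψ • 1
      - (gradJac d Gi f).map (d j) - ∑ k, gradJac d Gi f k j • Γ k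
      + gradJac d Gi f * Γ j - Γ j * gradJac d Gi f := by
  have e1 : ∑ k, grad d Gi f k • curv d Γ k j = (Γ j).map (gradDeriv d Gi f)
      - ∑ k, grad d Gi f k • (Γ k).map (d j) + (∑ k, grad d Gi f k • Γ k) * Γ j
      - Γ j * ∑ k, grad d Gi f k • Γ k := by
    simp only [map_gradDeriv, curv, smul_sub, smul_add, Finset.sum_add_distrib,
      Finset.sum_sub_distrib, Finset.sum_mul, Finset.mul_sum, Matrix.smul_mul, Matrix.mul_smul]
  have e2 : ∑ k, grad d Gi f k • (Γ k).map (d j) = (∑ k, grad d Gi f k • Γ k).map (d j)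
      - ∑ k, gradJac d Gi f k j • Γ k := by
    simp only [map_deriv_sum, map_deriv_smul, Finset.sum_add_distrib, gradJac, of_apply]
    abel
  have e3 : (ψ • (1 : Matrix ι ι A)).map (d j) = d j ψ • 1 := by
    rw [map_deriv_smul]
    have : (1 : Matrix ι ι A).map (d j) = 0 := by
      ext a b
      simp only [map_apply, one_apply]
      split_ifs <;> simp
    rw [this, smul_zero, add_zero]
  rw [e1, e2, h.sum_grad_smul_connection hGi hf, map_deriv_sub, e3]
  simp only [sub_mul, mul_sub, Matrix.smul_mul, Matrix.mul_smul, one_mul, mul_one]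
  abel

theorem gradDeriv_deriv (h : IsLeviCivita d G Γ) (i : ι) (a : A) :
    gradDeriv d Gi f (d i a) = d i (gradDeriv d Gi f a) - ∑ k, gradJac d Gi f k i * d k a := by
  simp only [gradDeriv_apply, map_sum, Derivation.leibniz, smul_eq_mul, Finset.sum_add_distrib,
    gradJac, of_apply, h.comm i]
  rw [eq_sub_iff_add_eq]
  congr 1
  exact Finset.sum_congr rfl fun k _ => mul_comm _ _

/-- The Lie derivative of the curvature is the exterior covariant derivative of the Lie derivative
of the connection. The part `dψ ⊗ 1` contributes nothing, being a closed form times the identity. -/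
theorem gradDeriv_curv (h : IsLeviCivita d G Γ) (L : ι → Matrix ι ι A) (ψ : A)
    (hL : ∀ j, (Γ j).map (gradDeriv d Gi f) = L j + d j ψ • 1
      - (gradJac d Gi f).map (d j) - ∑ k, gradJac d Gi f k j • Γ k
      + gradJac d Gi f * Γ j - Γ j * gradJac d Gi f) (i j : ι) :
    (curv d Γ i j).map (gradDeriv d Gi f) =
      ((L j).map (d i) + Γ i * L j - L j * Γ i) - ((L i).map (d j) + Γ j * L i - L i * Γ j)
      + gradJac d Gi f * curv d Γ i j - curv d Γ i j * gradJac d Gi f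
      - ∑ k, gradJac d Gi f k i • curv d Γ k j + ∑ k, gradJac d Gi f k j • curv d Γ k i := by
  set C := gradJac d Gi f with hC
  set D := gradDeriv d Gi f with hD
  have hone : ∀ i j, (d j ψ • (1 : Matrix ι ι A)).map (d i) = d i (d j ψ) • 1 := by
    intro i j
    rw [map_deriv_smul]
    have : (1 : Matrix ι ι A).map (d i) = 0 := by
      ext a b
      simp only [map_apply, one_apply]
      split_ifs <;> simp
    rw [this, smul_zero, add_zero]
  have e1 : ∀ i j, ((Γ j).map (d i)).map D = ((Γ j).map D).map (d i)
      - ∑ k, C k i • (Γ j).map (d k) := by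
    intro i j
    ext a b
    simp only [map_apply, Matrix.sub_apply, Matrix.sum_apply, Matrix.smul_apply, smul_eq_mul,
      hD, hC]
    exact h.gradDeriv_deriv i _
  have e2 : ∀ i j, ((Γ j).map D).map (d i) = (L j).map (d i) + d i (d j ψ) • 1
      - (C.map (d j)).map (d i) - ∑ k, d i (C k j) • Γ k - ∑ k, C k j • (Γ k).map (d i)
      + C.map (d i) * Γ j + C * (Γ j).map (d i) - (Γ j).map (d i) * C - Γ j * C.map (d i) := by
    intro i j
    rw [hL]
    simp only [map_deriv_sub, map_deriv_add, map_deriv_mul, map_deriv_sum, map_deriv_smul,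
      Finset.sum_add_distrib]
    rw [← map_deriv_smul, hone]
    abel
  have e3 : ∀ i j, ∑ k, C k i • curv d Γ k j = ∑ k, C k i • (Γ j).map (d k)
      - ∑ k, C k i • (Γ k).map (d j) + (∑ k, C k i • Γ k) * Γ j - Γ j * ∑ k, C k i • Γ k := by
    intro i j
    simp only [curv, smul_sub, smul_add, Finset.sum_add_distrib,
      Finset.sum_sub_distrib, Finset.sum_mul, Finset.mul_sum, Matrix.smul_mul, Matrix.mul_smul]
  have s1 : (C.map (d j)).map (d i) = (C.map (d i)).map (d j) := by
    ext a b; exact h.comm i j _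
  have s2 : ∀ k, d i (C k j) = d j (C k i) := fun k => h.comm i j _
  have lhs : (curv d Γ i j).map D = ((Γ j).map (d i)).map D - ((Γ i).map (d j)).map D
      + ((Γ i).map D * Γ j + Γ i * (Γ j).map D) - ((Γ j).map D * Γ i + Γ j * (Γ i).map D) := by
    conv_lhs => rw [curv]
    simp only [map_deriv_sub, map_deriv_add, map_deriv_mul]
  rw [lhs, e1, e1, e2, e2, hL, hL, e3, e3, s1, h.comm i j ψ]
  simp only [s2]
  generalize (∑ k, C k i • Γ k) = K1
  generalize (∑ k, C k j • Γ k) = K2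
  generalize (∑ k, C k i • (Γ j).map (d k)) = K3
  generalize (∑ k, C k j • (Γ i).map (d k)) = K4
  generalize (∑ k, C k i • (Γ k).map (d j)) = K5
  generalize (∑ k, C k j • (Γ k).map (d i)) = K6
  generalize (∑ k, d j (C k i) • Γ k) = K7
  rw [curv]
  simp only [add_mul, mul_add, sub_mul, mul_sub, Matrix.smul_mul, Matrix.mul_smul, one_mul,
    mul_one, mul_assoc]
  abel

end Conformal

end IsLeviCivita

end AlgRiem

/-! ### Scalar curvature along a conformal gradient field -/

namespace AlgRiem

open Matrix

variable {A : Type*} [CommRing A] [Algebra ℝ A] {ι : Type*} [Fintype ι] [DecidableEq ι]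
  {d : ι → Derivation ℝ A A} {G Gi : Matrix ι ι A} {Γ : ι → Matrix ι ι A} {f ψ : A}

/-- The Laplacian of `ψ`, as the divergence of its gradient. -/
def lapl (d : ι → Derivation ℝ A A) (Gi : Matrix ι ι A) (Γ : ι → Matrix ι ι A) (ψ : A) : A :=
  ∑ i, cov d Γ i (grad d Gi ψ) i

namespace IsLeviCivita

/-- The exterior covariant derivative of the part of the Lie derivative of the connection that
comes from the curvature. -/
theorem extDeriv_apply (h : IsLeviCivita d G Γ) (L : ι → Matrix ι ι A)
    (hL : ∀ j, L j = of fun a k => (if a = j then d k ψ else 0) - G j k * grad d Gi ψ a)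
    (i j a k : ι) :
    (((L j).map (d i) + Γ i * L j - L j * Γ i)
      - ((L i).map (d j) + Γ j * L i - L i * Γ j)) a k =
    (if a = j then hess d Γ ψ i k else 0) - (if a = i then hess d Γ ψ j k else 0)
      - G j k * cov d Γ i (grad d Gi ψ) a + G i k * cov d Γ j (grad d Gi ψ) a := by
  have e : ∀ i j, ((L j).map (d i) + Γ i * L j - L j * Γ i) a k =
      (if a = j then hess d Γ ψ i k else 0) - G j k * cov d Γ i (grad d Gi ψ) a
      + (Γ i a j * d k ψ - (G * Γ i) k j * grad d Gi ψ a) := by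
    intro i j
    have c : d i (G j k) = (G * Γ i) k j + (G * Γ i) j k := by
      have := congrFun (congrFun (h.compat i) j) k
      have e : (Γ i)ᵀ * G = (G * Γ i)ᵀ := by rw [transpose_mul, h.symm]
      rw [e] at this
      exact this
    have t1 : (Γ i * L j) a k = Γ i a j * d k ψ - G j k * (Γ i *ᵥ grad d Gi ψ) a := by
      simp only [hL, mul_apply, of_apply, mul_sub, Finset.sum_sub_distrib, mul_ite, mul_zero,
        Finset.sum_ite_eq', Finset.mem_univ, if_true, mulVec, dotProduct, Finset.mul_sum]
      congr 1
      exact Finset.sum_congr rfl fun m _ => by ring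
    have t2 : (L j * Γ i) a k = (if a = j then ∑ m, Γ i m k * d m ψ else 0)
        - grad d Gi ψ a * (G * Γ i) j k := by
      simp only [hL, mul_apply, of_apply, sub_mul, Finset.sum_sub_distrib, ite_mul, zero_mul,
        Finset.mul_sum]
      congr 1
      · split_ifs
        · exact Finset.sum_congr rfl fun m _ => by ring
        · simp
      · exact Finset.sum_congr rfl fun m _ => by ring
    have t3 : ((L j).map (d i)) a k = (if a = j then d i (d k ψ) else 0)
        - (d i (G j k) * grad d Gi ψ a + G j k * d i (grad d Gi ψ a)) := by
      rw [map_apply, hL, of_apply, map_sub, Derivation.leibniz]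
      congr 1
      · split_ifs <;> simp
      · simp only [smul_eq_mul]; ring
    rw [Matrix.sub_apply, Matrix.add_apply, t1, t2, t3, c, cov, Pi.add_apply, hess]
    split_ifs <;> ring
  have s : (G * Γ i) k j = (G * Γ j) k i := by
    simp only [mul_apply, h.torsion i j]
  rw [Matrix.sub_apply, e, e, h.torsion i j a, s]
  ring

/-- Contracting `gradDeriv_curv` gives `L_X Ric = -(n - 2)∇²ψ - (Δψ) g` for `X = ∇f`; the `gradJac`
terms again convert the Lie derivative into a derivative of components. -/
theorem gradDeriv_ric (h : IsLeviCivita d G Γ) (hGi : G * Gi = 1)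
    (hf : ∀ i j, hess d Γ f i j = ψ * G i j) :
    (of (ric d Γ)).map (gradDeriv d Gi f) = -((gradJac d Gi f)ᵀ * of (ric d Γ))
      - of (ric d Γ) * gradJac d Gi f + (2 - (Fintype.card ι : A)) • (of (hess d Γ ψ))ᵀ
      - lapl d Gi Γ ψ • G := by
  set C := gradJac d Gi f with hC
  ext l j
  have e : ∀ i, gradDeriv d Gi f (curv d Γ i j i l) =
      ((if i = j then hess d Γ ψ i l else 0) - hess d Γ ψ j l
      - G j l * cov d Γ i (grad d Gi ψ) i + G i l * cov d Γ j (grad d Gi ψ) i)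
      + ∑ a, C i a * curv d Γ i j a l - ∑ a, curv d Γ i j i a * C a l
      - ∑ k, C k i * curv d Γ k j i l - ∑ k, C k j * curv d Γ i k i l := by
    intro i
    have := congrFun (congrFun (h.gradDeriv_curv
      (fun j => ∑ k, grad d Gi f k • curv d Γ k j) ψ (h.gradDeriv_connection hGi hf) i j) i) l
    have e2 := h.extDeriv_apply (ψ := ψ) _ (h.sum_grad_smul_curv hGi hf) i j i l
    rw [map_apply] at this
    rw [this, Matrix.add_apply, Matrix.sub_apply, Matrix.sub_apply, Matrix.add_apply, e2,
      if_pos rfl]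
    simp only [mul_apply, Matrix.sum_apply, Matrix.smul_apply, smul_eq_mul, ← hC]
    have : ∑ k, C k j * curv d Γ k i i l = -∑ k, C k j * curv d Γ i k i l := by
      rw [← Finset.sum_neg_distrib]
      exact Finset.sum_congr rfl fun k _ => by rw [curv_antisymm k i, Matrix.neg_apply]; ring
    rw [this]; ring
  have hH : ∑ i, G i l * cov d Γ j (grad d Gi ψ) i = hess d Γ ψ j l := by
    rw [← h.mulVec_cov_grad hGi]
    exact Finset.sum_congr rfl fun i _ => by rw [symm_apply h.symm]
  have hx : ∑ i, ∑ k, C k i * curv d Γ k j i l = ∑ i, ∑ a, C i a * curv d Γ i j a l := by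
    rw [Finset.sum_comm]
  have hy : ∑ i, ∑ k, C k j * curv d Γ i k i l = ∑ k, ric d Γ l k * C k j := by
    rw [Finset.sum_comm]
    refine Finset.sum_congr rfl fun k _ => ?_
    rw [← Finset.mul_sum, mul_comm]; rfl
  have hz : ∑ i, ∑ a, curv d Γ i j i a * C a l = ∑ k, C k l * ric d Γ k j := by
    rw [Finset.sum_comm]
    refine Finset.sum_congr rfl fun k _ => ?_
    rw [← Finset.sum_mul, mul_comm]; rfl
  rw [map_apply, of_apply]
  conv_lhs => rw [ric, map_sum]
  simp only [e, Finset.sum_add_distrib, Finset.sum_sub_distrib, hH, hx, hy, hz,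
    Finset.sum_ite_eq', Finset.mem_univ, if_true, ← Finset.mul_sum, Finset.sum_const,
    Finset.card_univ, nsmul_eq_mul]
  simp only [Matrix.add_apply, Matrix.sub_apply, Matrix.neg_apply, Matrix.smul_apply,
    smul_eq_mul, mul_apply, transpose_apply, of_apply, lapl, symm_apply h.symm l j]
  ring

theorem gradDeriv_inv (h : IsLeviCivita d G Γ) (hGi : G * Gi = 1)
    (hf : ∀ i j, hess d Γ f i j = ψ * G i j) :
    Gi.map (gradDeriv d Gi f) = -(2 * ψ) • Gi + Gi * (gradJac d Gi f)ᵀ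
      + gradJac d Gi f * Gi := by
  set C := gradJac d Gi f with hC
  have hiG := mul_eq_one_comm.1 hGi
  have e : G.map (gradDeriv d Gi f) = (2 * ψ) • G - Cᵀ * G - G * C := by
    have : G.map (gradDeriv d Gi f) = (∑ k, grad d Gi f k • Γ k)ᵀ * G
        + G * ∑ k, grad d Gi f k • Γ k := by
      simp only [map_gradDeriv, h.compat, smul_add, Finset.sum_add_distrib, transpose_sum,
        transpose_smul, Finset.sum_mul, Finset.mul_sum, Matrix.smul_mul, Matrix.mul_smul]
    rw [this, h.sum_grad_smul_connection hGi hf, ← hC]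
    simp only [transpose_sub, transpose_smul, transpose_one, sub_mul, mul_sub, Matrix.smul_mul,
      Matrix.mul_smul, one_mul, mul_one, two_mul, add_smul]
    abel
  have e1 : (G * Gi).map (gradDeriv d Gi f) = 0 := by
    rw [hGi]
    ext a b
    simp only [map_apply, one_apply]
    split_ifs <;> simp
  rw [map_deriv_mul, e] at e1
  calc Gi.map (gradDeriv d Gi f) = Gi * (((2 * ψ) • G - Cᵀ * G - G * C) * Gi
        + G * Gi.map (gradDeriv d Gi f)) - Gi * (((2 * ψ) • G - Cᵀ * G - G * C) * Gi) := by
        rw [mul_add, ← mul_assoc Gi G, hiG, one_mul]; abel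
    _ = _ := by
        rw [e1]
        simp only [sub_mul, mul_sub, Matrix.smul_mul, Matrix.mul_smul, mul_assoc, hGi, mul_zero,
          mul_one]
        rw [← mul_assoc Gi G, hiG, one_mul, neg_smul]
        abel

/-- Trace of `L_X Ric` against the inverse metric, together with `L_X g⁻¹ = -2ψ g⁻¹`; the `gradJac`
terms cancel because the trace is cyclic. -/
theorem gradDeriv_scal (h : IsLeviCivita d G Γ) (hGi : G * Gi = 1)
    (hf : ∀ i j, hess d Γ f i j = ψ * G i j) :
    gradDeriv d Gi f (scal d Gi Γ) = -(2 * ((Fintype.card ι : A) - 1) * lapl d Gi Γ ψ)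
      - 2 * ψ * scal d Gi Γ := by
  have es : scal d Gi Γ = trace (Gi * (of (ric d Γ))ᵀ) := by
    simp [scal, trace, mul_apply]
  have et : ∀ M : Matrix ι ι A, gradDeriv d Gi f (trace M) = trace (M.map (gradDeriv d Gi f)) := by
    intro M; simp [trace]
  have eH : trace (Gi * of (hess d Γ ψ)) = lapl d Gi Γ ψ := by
    have : of (hess d Γ ψ) = (of fun i => cov d Γ i (grad d Gi ψ)) * G := by
      ext i k
      rw [of_apply, ← h.mulVec_cov_grad hGi]
      simp only [mulVec, dotProduct, mul_apply, of_apply]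
      exact Finset.sum_congr rfl fun m _ => by rw [symm_apply h.symm, mul_comm]
    rw [this, ← mul_assoc, trace_mul_comm, ← mul_assoc, hGi, one_mul]
    rfl
  have eG : trace (Gi * G) = (Fintype.card ι : A) := by
    rw [mul_eq_one_comm.1 hGi, trace_one]
  rw [es, et, map_deriv_mul, h.gradDeriv_inv hGi hf, map_deriv_transpose,
    h.gradDeriv_ric hGi hf]
  set C := gradJac d Gi f
  set R := of (ric d Γ)
  have e1 : trace (C * (Gi * Rᵀ)) = trace (Gi * (Rᵀ * C)) := by
    rw [trace_mul_comm, mul_assoc]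
  simp only [transpose_add, transpose_sub, transpose_neg, transpose_mul, transpose_smul,
    transpose_transpose, add_mul, mul_add, mul_sub, Matrix.smul_mul, Matrix.mul_smul,
    Matrix.mul_neg, trace_add, trace_sub, trace_neg, trace_smul, h.symm, eH, eG, smul_eq_mul,
    mul_assoc, e1]
  ring

theorem deriv_gradInner_of_conformal (h : IsLeviCivita d G Γ) (hGi : G * Gi = 1)
    (hf : ∀ i j, hess d Γ f i j = ψ * G i j) (i : ι) :
    d i (gradInner d Gi f f) = 2 * (ψ * d i f) := by
  rw [h.deriv_gradInner_self hGi]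
  have := congrFun (mulVec_grad (d := d) hGi f) i
  simp only [mulVec, dotProduct] at this
  simp only [hf, ← this, Finset.mul_sum]
  exact Finset.sum_congr rfl fun m _ => by ring

/-- `d|∇f|² = 2ψ df` is closed, so `dψ ∧ df = 0`. -/
theorem deriv_mul_deriv_comm (h : IsLeviCivita d G Γ) (hGi : G * Gi = 1)
    (hf : ∀ i j, hess d Γ f i j = ψ * G i j) (i j : ι) :
    d i ψ * d j f = d j ψ * d i f := by
  have := h.comm i j (gradInner d Gi f f)
  rw [h.deriv_gradInner_of_conformal hGi hf, h.deriv_gradInner_of_conformal hGi hf] at this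
  have t : ∀ D : Derivation ℝ A A, D 2 = 0 := fun D => by
    simpa using D.map_natCast 2
  simp only [Derivation.leibniz, smul_eq_mul, h.comm i j f, t] at this
  refine sub_eq_zero.1 (eq_zero_of_add_self ?_)
  linear_combination this

/-- Proportionality of `dψ` and `df` gives `w∇ψ = p∇f`; the identity is the divergence of both
sides. Keeping the factor `w` avoids division at critical points of `f`. -/
theorem gradInner_mul_lapl (h : IsLeviCivita d G Γ) (hGi : G * Gi = 1)
    (hf : ∀ i j, hess d Γ f i j = ψ * G i j) :
    gradInner d Gi f f * lapl d Gi Γ ψ = gradInner d Gi f (gradInner d Gi f ψ)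
      + ((Fintype.card ι : A) - 2) * ψ * gradInner d Gi f ψ := by
  set w := gradInner d Gi f f with hw
  set p := gradInner d Gi f ψ with hp
  have e1 : ∀ i, w * d i ψ = p * d i f := by
    intro i
    rw [hw, hp, gradInner_eq_sum_grad h.symm hGi, gradInner_eq_sum_grad h.symm hGi,
      Finset.sum_mul, Finset.sum_mul]
    refine Finset.sum_congr rfl fun k _ => ?_
    linear_combination grad d Gi f k * h.deriv_mul_deriv_comm hGi hf i k
  have e2 : ∀ k, w * grad d Gi ψ k = p * grad d Gi f k := by
    intro k
    simp only [grad, mulVec, dotProduct, Finset.mul_sum]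
    refine Finset.sum_congr rfl fun i _ => ?_
    linear_combination Gi k i * e1 i
  have cs : ∀ (a : A) (v : ι → A) i k, cov d Γ i (fun k => a * v k) k
      = d i a * v k + a * cov d Γ i v k := by
    intro a v i k
    simp only [cov, Pi.add_apply, Derivation.leibniz, smul_eq_mul, mulVec, dotProduct, mul_add,
      Finset.mul_sum]
    have : ∑ x, Γ i k x * (a * v x) = ∑ x, a * (Γ i k x * v x) :=
      Finset.sum_congr rfl fun m _ => by ring
    rw [this]; ring
  have e3 : ∀ i, d i w * grad d Gi ψ i + w * cov d Γ i (grad d Gi ψ) i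
      = d i p * grad d Gi f i + p * ψ := by
    intro i
    rw [← cs, funext e2, cs, h.cov_grad hGi hf, Pi.single_eq_same]
  have e4 := Finset.sum_congr (rfl : Finset.univ = Finset.univ (α := ι)) fun i _ => e3 i
  simp only [Finset.sum_add_distrib, ← Finset.mul_sum, Finset.sum_const, Finset.card_univ,
    nsmul_eq_mul] at e4
  have e5 : ∑ i, d i w * grad d Gi ψ i = 2 * ψ * p := by
    rw [hp, gradInner_comm h.symm hGi, gradInner_eq_sum_grad h.symm hGi, Finset.mul_sum]
    refine Finset.sum_congr rfl fun i _ => ?_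
    rw [hw, h.deriv_gradInner_of_conformal hGi hf]; ring
  have e6 : ∑ i, d i p * grad d Gi f i = gradInner d Gi f p := by
    rw [gradInner_eq_sum_grad h.symm hGi]
    exact Finset.sum_congr rfl fun i _ => mul_comm _ _
  rw [e5, e6] at e4
  rw [lapl]
  linear_combination e4

/-- If `∇²f = ψ g`, then the derivative of the scalar curvature along `∇f` is determined by `ψ`
and its derivatives along `∇f`. -/
theorem gradInner_scal (h : IsLeviCivita d G Γ) (hGi : G * Gi = 1)
    (hf : ∀ i j, hess d Γ f i j = ψ * G i j) :
    gradInner d Gi f f * gradInner d Gi f (scal d Gi Γ)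
      + 2 * ψ * gradInner d Gi f f * scal d Gi Γ
      + 2 * ((Fintype.card ι : A) - 1) * (gradInner d Gi f (gradInner d Gi f ψ)
        + ((Fintype.card ι : A) - 2) * ψ * gradInner d Gi f ψ) = 0 := by
  have e : gradInner d Gi f (scal d Gi Γ) = gradDeriv d Gi f (scal d Gi Γ) := by
    rw [gradInner_eq_sum_grad h.symm hGi, gradDeriv_apply]
  rw [e, h.gradDeriv_scal hGi hf, ← h.gradInner_mul_lapl hGi hf]
  ring

end IsLeviCivita

end AlgRiem

/-! ### The ring of smooth functions on an open set in a chart, and its coordinate derivations -/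

section SmoothOn

open Set Filter Topology

variable {n : ℕ} [NeZero n] {M : Type*} [TopologicalSpace M]
  [ChartedSpace (EuclideanHalfSpace n) M] {U : Set M}

variable (n) in
/-- The ring of functions on `U` that are restrictions of functions that are smooth on `U`. -/
def smoothOn (U : Set M) : Subalgebra ℝ (U → ℝ) where
  carrier := {F | ∃ F' : M → ℝ, ContMDiffOn (𝓡∂ n) 𝓘(ℝ, ℝ) ∞ F' U ∧ ∀ y : U, F' y = F y}
  mul_mem' := by
    rintro F K ⟨F', hF, hF'⟩ ⟨K', hK, hK'⟩
    exact ⟨F' * K', hF.mul hK, fun y => by simp [hF', hK']⟩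
  add_mem' := by
    rintro F K ⟨F', hF, hF'⟩ ⟨K', hK, hK'⟩
    exact ⟨F' + K', hF.add hK, fun y => by simp [hF', hK']⟩
  algebraMap_mem' r := ⟨fun _ => r, contMDiffOn_const, fun _ => rfl⟩

namespace smoothOn

instance : CoeFun (smoothOn n U) fun _ => U → ℝ := ⟨fun a => a.1⟩

/-- A function that is smooth on `U`, as an element of the ring. -/
def mk (F : M → ℝ) (hF : ContMDiffOn (𝓡∂ n) 𝓘(ℝ, ℝ) ∞ F U) : smoothOn n U :=
  ⟨fun y => F y, F, hF, fun _ => rfl⟩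

@[simp]
theorem mk_apply (F : M → ℝ) (hF : ContMDiffOn (𝓡∂ n) 𝓘(ℝ, ℝ) ∞ F U) (y : U) :
    mk F hF y = F y := rfl

/-- An extension of an element of the ring to the whole manifold. -/
def toFun (a : smoothOn n U) : M → ℝ := a.2.choose

theorem contMDiffOn_toFun (a : smoothOn n U) : ContMDiffOn (𝓡∂ n) 𝓘(ℝ, ℝ) ∞ (toFun a) U :=
  a.2.choose_spec.1

theorem toFun_apply (a : smoothOn n U) (y : U) : (toFun a) y = a y := a.2.choose_spec.2 y

@[ext]
theorem ext {a b : smoothOn n U} (h : ∀ y, a y = b y) : a = b := Subtype.ext (funext h)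

@[simp] theorem add_apply (a b : smoothOn n U) (y : U) : (a + b) y = a y + b y := rfl
@[simp] theorem sub_apply (a b : smoothOn n U) (y : U) : (a - b) y = a y - b y := rfl
@[simp] theorem mul_apply (a b : smoothOn n U) (y : U) : (a * b) y = a y * b y := rfl
@[simp] theorem zero_apply (y : U) : (0 : smoothOn n U) y = 0 := rfl
@[simp] theorem one_apply (y : U) : (1 : smoothOn n U) y = 1 := rfl
@[simp] theorem smul_apply (r : ℝ) (a : smoothOn n U) (y : U) : (r • a) y = r * a y := rfl

/-- Evaluation at a point. -/
def eval (y : U) : smoothOn n U →ₐ[ℝ] ℝ :=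
  (Pi.evalAlgHom ℝ (fun _ : U => ℝ) y).comp (smoothOn n U).val

theorem eval_apply (y : U) (a : smoothOn n U) : eval y a = a y := rfl

@[simp]
theorem sum_apply {κ : Type*} (s : Finset κ) (a : κ → smoothOn n U) (y : U) :
    (∑ k ∈ s, a k) y = ∑ k ∈ s, a k y := by
  simpa only [eval_apply] using map_sum (eval y) a s

variable [IsManifold (𝓡∂ n) ∞ M] {x : M}

theorem eventually_symm_mem (hU : IsOpen U) (hUx : U ⊆ (chartAt (EuclideanHalfSpace n) x).source)
    {y : M} (hy : y ∈ U) :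
    ∀ᶠ z in 𝓝[range (𝓡∂ n)] (extChartAt (𝓡∂ n) x y),
      (extChartAt (𝓡∂ n) x).symm z ∈ U ∧
        extChartAt (𝓡∂ n) x ((extChartAt (𝓡∂ n) x).symm z) = z := by
  have hy' : y ∈ (extChartAt (𝓡∂ n) x).source := by
    rw [extChartAt_source]; exact hUx hy
  have h1 : ∀ᶠ z in 𝓝[range (𝓡∂ n)] (extChartAt (𝓡∂ n) x y),
      (extChartAt (𝓡∂ n) x).symm z ∈ U := by
    refine (continuousAt_extChartAt_symm' hy').continuousWithinAt.preimage_mem_nhdsWithin ?_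
    rw [(extChartAt (𝓡∂ n) x).left_inv hy']
    exact hU.mem_nhds hy
  filter_upwards [h1, extChartAt_target_mem_nhdsWithin' hy'] with z hz hz'
  exact ⟨hz, (extChartAt (𝓡∂ n) x).right_inv hz'⟩

variable (x) in
/-- `F` is the expression in the chart at `x` of `a`. -/
def Represents (F : EuclideanSpace ℝ (Fin n) → ℝ) (a : smoothOn n U) : Prop :=
  ∀ y : U, F (extChartAt (𝓡∂ n) x y) = a y

theorem mem_range_extChartAt (x y : M) : extChartAt (𝓡∂ n) x y ∈ range (𝓡∂ n) := by
  simp [extChartAt]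

theorem uniqueDiffWithinAt_range (x y : M) :
    UniqueDiffWithinAt ℝ (range (𝓡∂ n)) (extChartAt (𝓡∂ n) x y) :=
  (𝓡∂ n).uniqueDiffOn _ (mem_range_extChartAt x y)

theorem represents_toFun (hUx : U ⊆ (chartAt (EuclideanHalfSpace n) x).source)
    (a : smoothOn n U) : Represents x ((toFun a) ∘ (extChartAt (𝓡∂ n) x).symm) a := by
  intro y
  have hy' : (y : M) ∈ (extChartAt (𝓡∂ n) x).source := by
    rw [extChartAt_source]; exact hUx y.2
  rw [Function.comp_apply, (extChartAt (𝓡∂ n) x).left_inv hy', toFun_apply]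

namespace Represents

variable {F F' : EuclideanSpace ℝ (Fin n) → ℝ} {a : smoothOn n U}

/-- Near an image point, the half-space lies in the image of `U`. Hence derivatives within the
half-space depend only on the ring element, not on the extension chosen by `toFun`. -/
theorem eventuallyEq (hU : IsOpen U) (hUx : U ⊆ (chartAt (EuclideanHalfSpace n) x).source)
    (h : Represents x F a) (h' : Represents x F' a) (y : U) :
    F =ᶠ[𝓝[range (𝓡∂ n)] (extChartAt (𝓡∂ n) x y)] F' := by
  filter_upwards [eventually_symm_mem hU hUx y.2] with z hz
  have e1 := h ⟨_, hz.1⟩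
  have e2 := h' ⟨_, hz.1⟩
  simp only [hz.2] at e1 e2
  rw [e1, e2]

theorem contDiffWithinAt (hU : IsOpen U)
    (hUx : U ⊆ (chartAt (EuclideanHalfSpace n) x).source) (h : Represents x F a) (y : U) :
    ContDiffWithinAt ℝ ∞ F (range (𝓡∂ n)) (extChartAt (𝓡∂ n) x y) := by
  have h1 : ContMDiffAt (𝓡∂ n) 𝓘(ℝ, ℝ) ∞ (toFun a) y :=
    (contMDiffOn_toFun a).contMDiffAt (hU.mem_nhds y.2)
  rw [contMDiffAt_iff_source_of_mem_source (hUx y.2), contMDiffWithinAt_iff_contDiffWithinAt]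
    at h1
  exact h1.congr_of_eventuallyEq (h.eventuallyEq hU hUx (represents_toFun hUx a) y)
    (by rw [h y, represents_toFun hUx a y])

theorem differentiableWithinAt (hU : IsOpen U)
    (hUx : U ⊆ (chartAt (EuclideanHalfSpace n) x).source) (h : Represents x F a) (y : U) :
    DifferentiableWithinAt ℝ F (range (𝓡∂ n)) (extChartAt (𝓡∂ n) x y) :=
  (h.contDiffWithinAt hU hUx y).differentiableWithinAt (by simp)

theorem partialDeriv_eq (hU : IsOpen U)
    (hUx : U ⊆ (chartAt (EuclideanHalfSpace n) x).source) (h : Represents x F a)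
    (h' : Represents x F' a) (i : Fin n) (y : U) :
    Coord.partialDeriv (range (𝓡∂ n)) i F (extChartAt (𝓡∂ n) x y)
      = Coord.partialDeriv (range (𝓡∂ n)) i F' (extChartAt (𝓡∂ n) x y) := by
  rw [Coord.partialDeriv, Coord.partialDeriv,
    (h.eventuallyEq hU hUx h' y).fderivWithin_eq (by rw [h y, h' y])]

end Represents

theorem contMDiffOn_comp_extChartAt
    (hUx : U ⊆ (chartAt (EuclideanHalfSpace n) x).source)
    {F : EuclideanSpace ℝ (Fin n) → ℝ}
    (hF : ∀ y ∈ U, ContDiffWithinAt ℝ ∞ F (range (𝓡∂ n)) (extChartAt (𝓡∂ n) x y)) :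
    ContMDiffOn (𝓡∂ n) 𝓘(ℝ, ℝ) ∞ (F ∘ extChartAt (𝓡∂ n) x) U := by
  intro y hy
  refine ContMDiffWithinAt.comp (t := range (𝓡∂ n)) (I' := 𝓘(ℝ, EuclideanSpace ℝ (Fin n))) y
    (contMDiffWithinAt_iff_contDiffWithinAt.2 (hF y hy))
    (contMDiffAt_extChartAt' (hUx hy)).contMDiffWithinAt ?_
  exact fun z _ => mem_range_extChartAt x z

theorem contMDiffOn_partialDeriv (hU : IsOpen U)
    (hUx : U ⊆ (chartAt (EuclideanHalfSpace n) x).source) (i : Fin n) (a : smoothOn n U) :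
    ContMDiffOn (𝓡∂ n) 𝓘(ℝ, ℝ) ∞ (Coord.partialDeriv (range (𝓡∂ n)) i
      ((toFun a) ∘ (extChartAt (𝓡∂ n) x).symm) ∘ extChartAt (𝓡∂ n) x) U := by
  refine contMDiffOn_comp_extChartAt hUx fun y hy => ?_
  exact ((represents_toFun hUx a).contDiffWithinAt hU hUx ⟨y, hy⟩).fderivWithin_right_apply
    contDiffWithinAt_const (𝓡∂ n).uniqueDiffOn (by simp) (mem_range_extChartAt x y)

/-- The coordinate derivations of the chart at `x`. -/
def coordDeriv (hU : IsOpen U) (hUx : U ⊆ (chartAt (EuclideanHalfSpace n) x).source)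
    (i : Fin n) : Derivation ℝ (smoothOn n U) (smoothOn n U) :=
  Derivation.mk'
    { toFun := fun a => mk _ (contMDiffOn_partialDeriv hU hUx i a)
      map_add' := fun a b => by
        ext y
        have hab : Represents x (((toFun a) ∘ (extChartAt (𝓡∂ n) x).symm)
            + ((toFun b) ∘ (extChartAt (𝓡∂ n) x).symm)) (a + b) := fun y => by
          rw [Pi.add_apply, represents_toFun hUx a y, represents_toFun hUx b y, add_apply]
        simp only [mk_apply, add_apply, Function.comp_apply]
        rw [(represents_toFun hUx _).partialDeriv_eq hU hUx hab i y, Coord.partialDeriv,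
          fderivWithin_add (uniqueDiffWithinAt_range x y)
            ((represents_toFun hUx a).differentiableWithinAt hU hUx y)
            ((represents_toFun hUx b).differentiableWithinAt hU hUx y)]
        rfl
      map_smul' := fun r a => by
        ext y
        have hab : Represents x (r • ((toFun a) ∘ (extChartAt (𝓡∂ n) x).symm)) (r • a) :=
          fun y => by
            rw [Pi.smul_apply, represents_toFun hUx a y, smul_apply, smul_eq_mul]
        simp only [mk_apply, RingHom.id_apply, smul_apply, Function.comp_apply]
        rw [(represents_toFun hUx _).partialDeriv_eq hU hUx hab i y, Coord.partialDeriv,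
          fderivWithin_const_smul (uniqueDiffWithinAt_range x y)
            ((represents_toFun hUx a).differentiableWithinAt hU hUx y)]
        rfl }
    (fun a b => by
      ext y
      have hab : Represents x (((toFun a) ∘ (extChartAt (𝓡∂ n) x).symm)
          * ((toFun b) ∘ (extChartAt (𝓡∂ n) x).symm)) (a * b) := fun y => by
        rw [Pi.mul_apply, represents_toFun hUx a y, represents_toFun hUx b y, mul_apply]
      simp only [LinearMap.coe_mk, AddHom.coe_mk, mk_apply, add_apply, Function.comp_apply,
        smul_eq_mul, mul_apply]
      rw [(represents_toFun hUx _).partialDeriv_eq hU hUx hab i y, Coord.partialDeriv,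
        fderivWithin_mul (uniqueDiffWithinAt_range x y)
          ((represents_toFun hUx a).differentiableWithinAt hU hUx y)
          ((represents_toFun hUx b).differentiableWithinAt hU hUx y),
        represents_toFun hUx a y, represents_toFun hUx b y]
      rfl)

theorem Represents.partialDeriv (hU : IsOpen U)
    (hUx : U ⊆ (chartAt (EuclideanHalfSpace n) x).source)
    {F : EuclideanSpace ℝ (Fin n) → ℝ} {a : smoothOn n U} (h : Represents x F a) (i : Fin n) :
    Represents x (Coord.partialDeriv (range (𝓡∂ n)) i F) (coordDeriv hU hUx i a) := fun y =>
  h.partialDeriv_eq hU hUx (represents_toFun hUx a) i y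

theorem coordDeriv_comm (hU : IsOpen U)
    (hUx : U ⊆ (chartAt (EuclideanHalfSpace n) x).source) (i j : Fin n) (a : smoothOn n U) :
    coordDeriv hU hUx i (coordDeriv hU hUx j a) = coordDeriv hU hUx j (coordDeriv hU hUx i a) := by
  ext y
  have h := represents_toFun hUx a
  have hs : ∀ i j, coordDeriv hU hUx i (coordDeriv hU hUx j a) y
      = fderivWithin ℝ (fderivWithin ℝ ((toFun a) ∘ (extChartAt (𝓡∂ n) x).symm) (range (𝓡∂ n)))
        (range (𝓡∂ n)) (extChartAt (𝓡∂ n) x y) (EuclideanSpace.single i 1)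
        (EuclideanSpace.single j 1) := by
    intro i j
    rw [← (h.partialDeriv hU hUx j).partialDeriv hU hUx i y, Coord.partialDeriv]
    have hd : DifferentiableWithinAt ℝ (fderivWithin ℝ ((toFun a) ∘ (extChartAt (𝓡∂ n) x).symm)
        (range (𝓡∂ n))) (range (𝓡∂ n)) (extChartAt (𝓡∂ n) x y) :=
      ((h.contDiffWithinAt hU hUx y).fderivWithin_right (m := ∞) (𝓡∂ n).uniqueDiffOn (by simp)
        (mem_range_extChartAt x y)).differentiableWithinAt (by simp)
    unfold Coord.partialDeriv
    rw [fderivWithin_clm_apply (uniqueDiffWithinAt_range x y) hd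
      (differentiableWithinAt_const _)]
    simp
  rw [hs, hs]
  -- Symmetry of the second derivative also holds at boundary points, since the half-space lies in
  -- the closure of its interior.
  refine (h.contDiffWithinAt hU hUx y).isSymmSndFDerivWithinAt
    (by rw [minSmoothness_of_isRCLikeNormedField]; exact WithTop.coe_le_coe.2 le_top) (𝓡∂ n).uniqueDiffOn ?_
    (mem_range_extChartAt x y) _ _
  exact (𝓡∂ n).range_subset_closure_interior (mem_range_extChartAt x y)

end smoothOn

end SmoothOn

/-! ### Coordinate frames, the Gram matrix and change of charts -/

section Frame

open Set Filter Topology Bundle smoothOn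

variable {n : ℕ} [NeZero n] {M : Type*} [TopologicalSpace M]
  [ChartedSpace (EuclideanHalfSpace n) M] [IsManifold (𝓡∂ n) ∞ M] {U : Set M} {x x' : M}

variable (n) in
/-- The `i`-th coordinate vector field of the chart at `x`. -/
def coordFrame (x : M) (i : Fin n) (y : M) : TangentSpace (𝓡∂ n) y :=
  (trivializationAt (EuclideanSpace ℝ (Fin n)) (TangentSpace (𝓡∂ n) : M → Type _) x).symmL ℝ y
    (EuclideanSpace.single i 1)

theorem coordFrame_eq {y : M} (hy : y ∈ (chartAt (EuclideanHalfSpace n) x).source) (i : Fin n) :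
    (coordFrame n x i y : EuclideanSpace ℝ (Fin n)) =
      mfderivWithin 𝓘(ℝ, EuclideanSpace ℝ (Fin n)) (𝓡∂ n) (extChartAt (𝓡∂ n) x).symm
        (range (𝓡∂ n)) (extChartAt (𝓡∂ n) x y) (EuclideanSpace.single i 1) := by
  rw [coordFrame, TangentBundle.symmL_trivializationAt hy]
  rfl

theorem contMDiffOn_coordFrame (x : M) (i : Fin n) :
    ContMDiffOn (𝓡∂ n) ((𝓡∂ n).prod 𝓘(ℝ, EuclideanSpace ℝ (Fin n))) ∞
      (fun y => TotalSpace.mk' (EuclideanSpace ℝ (Fin n)) y (coordFrame n x i y))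
      (chartAt (EuclideanHalfSpace n) x).source := by
  intro y hy
  rw [Trivialization.contMDiffWithinAt_section
    (e := trivializationAt (EuclideanSpace ℝ (Fin n)) (TangentSpace (𝓡∂ n) : M → Type _) x) _
    (by simpa using hy)]
  refine (contMDiffWithinAt_const (c := EuclideanSpace.single i (1 : ℝ))).congr_of_mem
    (fun z hz => ?_) hy
  have hz' : z ∈ (trivializationAt (EuclideanSpace ℝ (Fin n))
    (TangentSpace (𝓡∂ n) : M → Type _) x).baseSet := by simpa using hz
  rw [coordFrame, Trivialization.symmL_apply _ hz', Trivialization.apply_mk_symm _ hz']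

/-- The coordinate derivations become chart-independent differentials evaluated on frame vectors, so
charts can be compared by expanding one frame in the other. -/
theorem coordDeriv_apply (hU : IsOpen U)
    (hUx : U ⊆ (chartAt (EuclideanHalfSpace n) x).source) (i : Fin n) (a : smoothOn n U) (y : U) :
    coordDeriv hU hUx i a y
      = mfderiv (𝓡∂ n) 𝓘(ℝ, ℝ) (toFun a) y (coordFrame n x i y) := by
  have hy : (y : M) ∈ (extChartAt (𝓡∂ n) x).source := by
    rw [extChartAt_source]; exact hUx y.2
  have hs := (extChartAt (𝓡∂ n) x).left_inv hy
  have hd : MDifferentiableAt (𝓡∂ n) 𝓘(ℝ, ℝ) (toFun a) y :=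
    ((contMDiffOn_toFun a).contMDiffAt (hU.mem_nhds y.2)).mdifferentiableAt (by simp)
  have hc : MDifferentiableWithinAt 𝓘(ℝ, EuclideanSpace ℝ (Fin n)) (𝓡∂ n)
      (extChartAt (𝓡∂ n) x).symm (range (𝓡∂ n)) (extChartAt (𝓡∂ n) x y) :=
    mdifferentiableWithinAt_extChartAt_symm ((extChartAt (𝓡∂ n) x).map_source hy)
  rw [← (represents_toFun hUx a).partialDeriv hU hUx i y, Coord.partialDeriv,
    ← mfderivWithin_eq_fderivWithin, mfderiv_comp_mfderivWithin_of_eq hd hc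
      (uniqueDiffWithinAt_range x (y : M)).uniqueMDiffWithinAt hs]
  exact congrArg (mfderiv (𝓡∂ n) 𝓘(ℝ, ℝ) (toFun a) (y : M)) (coordFrame_eq (hUx y.2) i).symm

/-- The `a`-th coordinate function of the chart at `x`. -/
def coordFun (hUx : U ⊆ (chartAt (EuclideanHalfSpace n) x).source) (a : Fin n) : smoothOn n U :=
  mk (fun y => extChartAt (𝓡∂ n) x y a) (contMDiffOn_comp_extChartAt hUx
    (F := fun z : EuclideanSpace ℝ (Fin n) => z a) fun _ _ =>
      (EuclideanSpace.proj (𝕜 := ℝ) a).contDiff.contDiffWithinAt)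

theorem coordDeriv_coordFun (hU : IsOpen U)
    (hUx : U ⊆ (chartAt (EuclideanHalfSpace n) x).source) (i a : Fin n) (y : U) :
    coordDeriv hU hUx i (coordFun hUx a) y = if a = i then 1 else 0 := by
  have h : Represents x (EuclideanSpace.proj (𝕜 := ℝ) a) (coordFun hUx a) := fun y => rfl
  rw [← h.partialDeriv hU hUx i y, Coord.partialDeriv,
    ContinuousLinearMap.fderivWithin _ (uniqueDiffWithinAt_range x y)]
  simp [PiLp.single_apply]

theorem mfderiv_extChartAt_apply (hU : IsOpen U)
    (hUx : U ⊆ (chartAt (EuclideanHalfSpace n) x).source) (a : Fin n) (y : U)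
    (v : TangentSpace (𝓡∂ n) (y : M)) :
    mfderiv (𝓡∂ n) 𝓘(ℝ, ℝ) (toFun (coordFun hUx a)) y v =
      EuclideanSpace.proj (𝕜 := ℝ) a
        (mfderiv (𝓡∂ n) 𝓘(ℝ, EuclideanSpace ℝ (Fin n)) (extChartAt (𝓡∂ n) x) y v) := by
  have e : toFun (coordFun hUx a) =ᶠ[𝓝 (y : M)]
      (EuclideanSpace.proj (𝕜 := ℝ) a) ∘ extChartAt (𝓡∂ n) x := by
    filter_upwards [hU.mem_nhds y.2] with z hz
    exact toFun_apply (coordFun hUx a) ⟨z, hz⟩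
  rw [e.mfderiv_eq, mfderiv_comp (I' := 𝓘(ℝ, EuclideanSpace ℝ (Fin n))) _
    (EuclideanSpace.proj (𝕜 := ℝ) a).mdifferentiableAt
    (mdifferentiableAt_extChartAt (hUx y.2)), ContinuousLinearMap.mfderiv_eq]
  rfl

theorem eq_sum_single (w : EuclideanSpace ℝ (Fin n)) :
    w = ∑ a, w a • EuclideanSpace.single a (1 : ℝ) := by
  ext b
  simp [Pi.single_apply]

/-- The Jacobian of the change of charts. -/
def coordJac (hU : IsOpen U) (hUx : U ⊆ (chartAt (EuclideanHalfSpace n) x).source)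
    (hUx' : U ⊆ (chartAt (EuclideanHalfSpace n) x').source) :
    Matrix (Fin n) (Fin n) (smoothOn n U) :=
  Matrix.of fun a i => coordDeriv hU hUx i (coordFun hUx' a)

theorem coordFrame_eq_sum (hU : IsOpen U)
    (hUx : U ⊆ (chartAt (EuclideanHalfSpace n) x).source)
    (hUx' : U ⊆ (chartAt (EuclideanHalfSpace n) x').source) (i : Fin n) (y : U) :
    coordFrame n x i y = ∑ a, coordJac hU hUx hUx' a i y • coordFrame n x' a (y : M) := by
  have hy' : (y : M) ∈ (trivializationAt (EuclideanSpace ℝ (Fin n))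
    (TangentSpace (𝓡∂ n) : M → Type _) x').baseSet := by simpa using hUx' y.2
  rw [← Trivialization.symmL_continuousLinearMapAt (R := ℝ) _ hy' (coordFrame n x i y),
    TangentBundle.continuousLinearMapAt_trivializationAt (hUx' y.2)]
  have e : (mfderiv (𝓡∂ n) 𝓘(ℝ, EuclideanSpace ℝ (Fin n)) (extChartAt (𝓡∂ n) x') y
      (coordFrame n x i y) : EuclideanSpace ℝ (Fin n))
      = ∑ a, coordJac hU hUx hUx' a i y • EuclideanSpace.single a (1 : ℝ) := by
    refine (eq_sum_single _).trans (Finset.sum_congr rfl fun a _ => ?_)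
    rw [coordJac, Matrix.of_apply, coordDeriv_apply hU hUx, mfderiv_extChartAt_apply hU hUx']
    rfl
  refine (congrArg _ e).trans ?_
  rw [map_sum]
  exact Finset.sum_congr rfl fun a _ => map_smul _ _ _

theorem coordDeriv_eq_sum (hU : IsOpen U)
    (hUx : U ⊆ (chartAt (EuclideanHalfSpace n) x).source)
    (hUx' : U ⊆ (chartAt (EuclideanHalfSpace n) x').source) (i : Fin n) (f : smoothOn n U) :
    coordDeriv hU hUx i f = ∑ a, coordJac hU hUx hUx' a i * coordDeriv hU hUx' a f := by
  ext y
  simp only [coordDeriv_apply, smoothOn.sum_apply, smoothOn.mul_apply]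
  rw [coordFrame_eq_sum hU hUx hUx', map_sum]
  exact Finset.sum_congr rfl fun a _ => map_smul _ _ _

/-- The matrix of the metric in the chart at `x`. -/
def gramOn (g : RiemMetric n M) (hUx : U ⊆ (chartAt (EuclideanHalfSpace n) x).source) :
    Matrix (Fin n) (Fin n) (smoothOn n U) :=
  Matrix.of fun i j => mk (fun y => g.inner y (coordFrame n x i y) (coordFrame n x j y)) <| by
    have h : ContMDiffOn (𝓡∂ n) ((𝓡∂ n).prod 𝓘(ℝ, ℝ)) ∞
        (fun y => TotalSpace.mk' ℝ (E := Trivial M ℝ) y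
          (g.inner y (coordFrame n x i y) (coordFrame n x j y))) U := by
      intro y hy
      apply ContMDiffWithinAt.clm_bundle_apply₂ (F₁ := EuclideanSpace ℝ (Fin n))
        (F₂ := EuclideanSpace ℝ (Fin n))
      · exact g.contMDiff.contMDiffAt.contMDiffWithinAt
      · exact ((contMDiffOn_coordFrame x i).mono hUx) y hy
      · exact ((contMDiffOn_coordFrame x j).mono hUx) y hy
    intro y hy
    have := h y hy
    simp only [contMDiffWithinAt_totalSpace] at this
    exact this.2

theorem gramOn_apply (g : RiemMetric n M)
    (hUx : U ⊆ (chartAt (EuclideanHalfSpace n) x).source) (i j : Fin n) (y : U) :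
    gramOn g hUx i j y = g.inner y (coordFrame n x i y) (coordFrame n x j (y : M)) := rfl

theorem represents_gram (g : RiemMetric n M)
    (hUx : U ⊆ (chartAt (EuclideanHalfSpace n) x).source) (i j : Fin n) :
    Represents x (fun z => g.gram (chartAt (EuclideanHalfSpace n) x) z i j)
      (gramOn g hUx i j) := by
  intro y
  have hy : (y : M) ∈ (extChartAt (𝓡∂ n) x).source := by
    rw [extChartAt_source]; exact hUx y.2
  have hs := (extChartAt (𝓡∂ n) x).left_inv hy
  -- All tangent spaces are the same model space, so vectors can be kept fixed while the base point
  -- is rewritten.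
  have key : ∀ p q : M, p = q → ∀ v w : EuclideanSpace ℝ (Fin n),
      g.inner p (v : TangentSpace (𝓡∂ n) p) (w : TangentSpace (𝓡∂ n) p)
        = g.inner q (v : TangentSpace (𝓡∂ n) q) (w : TangentSpace (𝓡∂ n) q) := by
    rintro p _ rfl v w; rfl
  rw [gramOn_apply]
  refine (key _ _ hs _ _).trans ?_
  exact congrArg₂ (fun v w : TangentSpace (𝓡∂ n) (y : M) => g.inner y v w)
    (coordFrame_eq (hUx y.2) i).symm (coordFrame_eq (hUx y.2) j).symm

theorem gramOn_transpose (g : RiemMetric n M)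
    (hUx : U ⊆ (chartAt (EuclideanHalfSpace n) x).source) : (gramOn g hUx).transpose = gramOn g hUx := by
  ext i j y
  rw [Matrix.transpose_apply, gramOn_apply, gramOn_apply, g.symm]

theorem coordFrame_sum_eq_zero {y : M} (hy : y ∈ (chartAt (EuclideanHalfSpace n) x).source)
    {v : Fin n → ℝ} (h : ∑ i, v i • coordFrame n x i y = 0) : v = 0 := by
  have hy' : y ∈ (trivializationAt (EuclideanSpace ℝ (Fin n))
    (TangentSpace (𝓡∂ n) : M → Type _) x).baseSet := by simpa using hy
  have e : (trivializationAt (EuclideanSpace ℝ (Fin n)) (TangentSpace (𝓡∂ n) : M → Type _)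
      x).symmL ℝ y (∑ i, v i • EuclideanSpace.single i (1 : ℝ)) = 0 := by
    rw [map_sum, ← h]
    exact Finset.sum_congr rfl fun a _ => map_smul _ _ _
  have e2 := congrArg ((trivializationAt (EuclideanSpace ℝ (Fin n))
    (TangentSpace (𝓡∂ n) : M → Type _) x).continuousLinearMapAt ℝ y) e
  rw [Trivialization.continuousLinearMapAt_symmL _ hy', map_zero] at e2
  ext j
  have := congrArg (fun u : EuclideanSpace ℝ (Fin n) => u j) e2
  simpa [Pi.single_apply] using this

theorem dotProduct_gram (g : RiemMetric n M)
    (hUx : U ⊆ (chartAt (EuclideanHalfSpace n) x).source) (y : U) (v : Fin n → ℝ) :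
    dotProduct v (((gramOn g hUx).map (eval y)).mulVec v)
      = g.inner y (∑ i, v i • coordFrame n x i (y : M)) (∑ i, v i • coordFrame n x i (y : M)) := by
  simp only [map_sum, map_smul, _root_.sum_apply, _root_.smul_apply, dotProduct, Matrix.mulVec, Matrix.map_apply, eval_apply,
    gramOn_apply, smul_eq_mul, Finset.mul_sum]
  rw [Finset.sum_comm]
  exact Finset.sum_congr rfl fun i _ => Finset.sum_congr rfl fun j _ => by ring

theorem dotProduct_gram_pos (g : RiemMetric n M)
    (hUx : U ⊆ (chartAt (EuclideanHalfSpace n) x).source) (y : U) {v : Fin n → ℝ} (hv : v ≠ 0) :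
    0 < dotProduct v (((gramOn g hUx).map (eval y)).mulVec v) := by
  rw [dotProduct_gram]
  exact g.pos _ _ fun h => hv (coordFrame_sum_eq_zero (hUx y.2) h)

theorem smoothOn.isUnit_of_ne_zero {a : smoothOn n U} (ha : ∀ y, a y ≠ 0) :
    IsUnit a := by
  have h : ContMDiffOn (𝓡∂ n) 𝓘(ℝ, ℝ) ∞ (fun y => (toFun a y)⁻¹) U := by
    intro y hy
    refine ((contMDiffOn_toFun a) y hy).inv₀ ?_
    rw [toFun_apply a ⟨y, hy⟩]; exact ha _
  refine IsUnit.of_mul_eq_one (mk _ h) ?_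
  ext y
  rw [mul_apply, mk_apply, toFun_apply, one_apply, mul_inv_cancel₀ (ha y)]

/-- Positive definiteness makes the determinant nonzero at every point, and a nowhere vanishing
smooth function is a unit of the ring. -/
theorem isUnit_det_gramOn (g : RiemMetric n M)
    (hUx : U ⊆ (chartAt (EuclideanHalfSpace n) x).source) : IsUnit (gramOn g hUx).det := by
  refine isUnit_of_ne_zero fun y h => ?_
  have : ((gramOn g hUx).map (eval y)).det = 0 := by
    rw [← h, ← eval_apply, AlgHom.map_det]; rfl
  obtain ⟨v, hv, hv'⟩ := Matrix.exists_mulVec_eq_zero_iff.2 this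
  have := dotProduct_gram_pos g hUx y hv
  rw [hv', dotProduct_zero] at this
  exact lt_irrefl _ this

theorem gramOn_mul_inv (g : RiemMetric n M)
    (hUx : U ⊆ (chartAt (EuclideanHalfSpace n) x).source) :
    gramOn g hUx * (gramOn g hUx)⁻¹ = 1 :=
  Matrix.mul_nonsing_inv _ (isUnit_det_gramOn g hUx)

theorem represents_gram_inv (g : RiemMetric n M)
    (hUx : U ⊆ (chartAt (EuclideanHalfSpace n) x).source) (i j : Fin n) :
    Represents x (fun z => (g.gram (chartAt (EuclideanHalfSpace n) x) z)⁻¹ i j)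
      ((gramOn g hUx)⁻¹ i j) := by
  intro y
  have e : g.gram (chartAt (EuclideanHalfSpace n) x) (extChartAt (𝓡∂ n) x y)
      = (gramOn g hUx).map (eval y) := by
    ext k l; exact represents_gram g hUx k l y
  have : (gramOn g hUx).map (eval y) * ((gramOn g hUx)⁻¹).map (eval y) = 1 := by
    rw [← Matrix.map_mul, gramOn_mul_inv, Matrix.map_one _ (map_zero _) (map_one _)]
  simp only [e, Matrix.inv_eq_right_inv this]
  rfl

theorem isFrameChange_coord (hU : IsOpen U) (g : RiemMetric n M)
    (hUx : U ⊆ (chartAt (EuclideanHalfSpace n) x).source)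
    (hUx' : U ⊆ (chartAt (EuclideanHalfSpace n) x').source) :
    AlgRiem.IsFrameChange (coordDeriv hU hUx) (coordDeriv hU hUx') (gramOn g hUx)
      (gramOn g hUx') (coordJac hU hUx hUx') (coordJac hU hUx' hUx) where
  deriv_eq := coordDeriv_eq_sum hU hUx hUx'
  closed i j a := coordDeriv_comm hU hUx i j _
  metric_eq := by
    ext i j y
    simp only [gramOn_apply, coordFrame_eq_sum hU hUx hUx', map_sum, map_smul,
      _root_.sum_apply, _root_.smul_apply, Matrix.mul_apply,
      Matrix.transpose_apply, smoothOn.sum_apply, smoothOn.mul_apply, smul_eq_mul, Finset.mul_sum, Finset.sum_mul]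
    refine Finset.sum_congr rfl fun i _ => Finset.sum_congr rfl fun j _ => by ring
  inv := by
    ext a b y
    -- The chain rule applied to the coordinate functions of the chart at `x'` says that the two
    -- Jacobians are inverse to each other.
    have h := coordDeriv_eq_sum hU hUx' hUx b (coordFun hUx' a)
    have e : (coordJac hU hUx hUx' * coordJac hU hUx' hUx) a b
        = coordDeriv hU hUx' b (coordFun hUx' a) := by
      rw [h, Matrix.mul_apply]
      exact Finset.sum_congr rfl fun i _ => mul_comm _ _
    rw [e, coordDeriv_coordFun, Matrix.one_apply]
    split_ifs <;> rfl

end Frame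

/-! ### Coordinate formulas as elements of the ring, and their independence of the chart -/

section Represent

open Set Filter Topology Bundle smoothOn

variable {n : ℕ} [NeZero n] {M : Type*} [TopologicalSpace M]
  [ChartedSpace (EuclideanHalfSpace n) M] [IsManifold (𝓡∂ n) ∞ M] {U : Set M} {x x' : M}
  (g : RiemMetric n M)

/-- The Christoffel matrices in the chart at `x`. -/
def christoffelOn (hU : IsOpen U) (hUx : U ⊆ (chartAt (EuclideanHalfSpace n) x).source) :
    Fin n → Matrix (Fin n) (Fin n) (smoothOn n U) :=
  AlgRiem.chr (coordDeriv hU hUx) (gramOn g hUx) (gramOn g hUx)⁻¹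

theorem isLeviCivita_christoffelOn (hU : IsOpen U)
    (hUx : U ⊆ (chartAt (EuclideanHalfSpace n) x).source) :
    AlgRiem.IsLeviCivita (coordDeriv hU hUx) (gramOn g hUx) (christoffelOn g hU hUx) :=
  AlgRiem.isLeviCivita_chr (coordDeriv_comm hU hUx) (gramOn_transpose g hUx)
    (gramOn_mul_inv g hUx)

theorem represents_christoffel (hU : IsOpen U)
    (hUx : U ⊆ (chartAt (EuclideanHalfSpace n) x).source) (k i j : Fin n) :
    Represents x (Coord.christoffel (range (𝓡∂ n))
      (g.gram (chartAt (EuclideanHalfSpace n) x)) k i j) (christoffelOn g hU hUx i k j) := by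
  intro y
  have h := fun m i j => (represents_gram g hUx i j).partialDeriv hU hUx m y
  have h' := fun i j => represents_gram_inv g hUx i j y
  simp only [Coord.christoffel, christoffelOn, AlgRiem.chr, Matrix.of_apply, smoothOn.smul_apply,
    smoothOn.sum_apply, smoothOn.mul_apply, smoothOn.sub_apply, smoothOn.add_apply, h, ← h']

theorem smoothOn.Represents.hess (hU : IsOpen U)
    (hUx : U ⊆ (chartAt (EuclideanHalfSpace n) x).source)
    {F : EuclideanSpace ℝ (Fin n) → ℝ} {a : smoothOn n U} (h : Represents x F a) (i j : Fin n) :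
    Represents x (Coord.hess (range (𝓡∂ n)) (g.gram (chartAt (EuclideanHalfSpace n) x)) F i j)
      (AlgRiem.hess (coordDeriv hU hUx) (christoffelOn g hU hUx) a i j) := by
  intro y
  have h1 := fun k => h.partialDeriv hU hUx k y
  have h2 := (h.partialDeriv hU hUx j).partialDeriv hU hUx i y
  have h3 := fun k i j => represents_christoffel g hU hUx k i j y
  simp only [Coord.hess, AlgRiem.hess, smoothOn.sub_apply, smoothOn.sum_apply,
    smoothOn.mul_apply, h1, h2, h3]

theorem smoothOn.Represents.gradInner (hU : IsOpen U)
    (hUx : U ⊆ (chartAt (EuclideanHalfSpace n) x).source)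
    {F F' : EuclideanSpace ℝ (Fin n) → ℝ} {a b : smoothOn n U} (h : Represents x F a)
    (h' : Represents x F' b) :
    Represents x (Coord.gradInner (range (𝓡∂ n)) (g.gram (chartAt (EuclideanHalfSpace n) x)) F F')
      (AlgRiem.gradInner (coordDeriv hU hUx) (gramOn g hUx)⁻¹ a b) := by
  intro y
  have h1 := fun k => h.partialDeriv hU hUx k y
  have h2 := fun k => h'.partialDeriv hU hUx k y
  have h3 := fun i j => represents_gram_inv g hUx i j y
  simp only [Coord.gradInner, AlgRiem.gradInner, smoothOn.sum_apply, smoothOn.mul_apply, h1, h2,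
    ← h3]

theorem represents_ricci (hU : IsOpen U)
    (hUx : U ⊆ (chartAt (EuclideanHalfSpace n) x).source) (i j : Fin n) :
    Represents x (Coord.ricci (range (𝓡∂ n)) (g.gram (chartAt (EuclideanHalfSpace n) x)) i j)
      (AlgRiem.ric (coordDeriv hU hUx) (christoffelOn g hU hUx) i j) := by
  intro y
  have h1 := fun k i j => represents_christoffel g hU hUx k i j y
  have h2 := fun m k i j =>
    (represents_christoffel g hU hUx k i j).partialDeriv hU hUx m y
  have t := (isLeviCivita_christoffelOn g hU hUx).torsion
  simp only [Coord.ricci, AlgRiem.ric, AlgRiem.curv, smoothOn.sum_apply, Matrix.add_apply,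
    Matrix.sub_apply, Matrix.map_apply, Matrix.mul_apply, smoothOn.sub_apply,
    smoothOn.add_apply, smoothOn.mul_apply, h1, h2]
  -- The two curvature conventions differ in the order of the lower Christoffel indices, which
  -- vanishing torsion makes immaterial.
  simp only [t i j, t i, Finset.sum_sub_distrib, Finset.sum_add_distrib]
  ring

theorem represents_scalarCurvature (hU : IsOpen U)
    (hUx : U ⊆ (chartAt (EuclideanHalfSpace n) x).source) :
    Represents x
      (Coord.scalarCurvature (range (𝓡∂ n)) (g.gram (chartAt (EuclideanHalfSpace n) x)))
      (AlgRiem.scal (coordDeriv hU hUx) (gramOn g hUx)⁻¹ (christoffelOn g hU hUx)) := by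
  intro y
  have h1 := fun i j => represents_ricci g hU hUx i j y
  have h3 := fun i j => represents_gram_inv g hUx i j y
  simp only [Coord.scalarCurvature, AlgRiem.scal, smoothOn.sum_apply, smoothOn.mul_apply, h1,
    ← h3]

theorem represents_mk (hUx : U ⊆ (chartAt (EuclideanHalfSpace n) x).source)
    {f : M → ℝ} (hf : ContMDiffOn (𝓡∂ n) 𝓘(ℝ, ℝ) ∞ f U) :
    Represents x (f ∘ (extChartAt (𝓡∂ n) x).symm) (mk f hf) := by
  intro y
  have hy' : (y : M) ∈ (extChartAt (𝓡∂ n) x).source := by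
    rw [extChartAt_source]; exact hUx y.2
  rw [Function.comp_apply, (extChartAt (𝓡∂ n) x).left_inv hy', mk_apply]

variable {g}

/-- The left side uses the preferred chart of the moving point `y`, the right side one fixed chart.
On the overlap `scal_eq` compares them; passing from the overlap back to `U` does not change the
expression in the chart at `x`. -/
theorem scalarCurvature_eq (hU : IsOpen U)
    (hUx : U ⊆ (chartAt (EuclideanHalfSpace n) x).source) (y : U) :
    g.scalarCurvature y
      = AlgRiem.scal (coordDeriv hU hUx) (gramOn g hUx)⁻¹ (christoffelOn g hU hUx) y := by
  have hV : IsOpen (U ∩ (chartAt (EuclideanHalfSpace n) (y : M)).source) :=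
    hU.inter (chartAt (EuclideanHalfSpace n) (y : M)).open_source
  have hVx : U ∩ (chartAt (EuclideanHalfSpace n) (y : M)).source ⊆
      (chartAt (EuclideanHalfSpace n) x).source := fun z hz => hUx hz.1
  have hVy : U ∩ (chartAt (EuclideanHalfSpace n) (y : M)).source ⊆ _ := inter_subset_right
  have hy := And.intro y.2 (mem_chart_source (EuclideanHalfSpace n) (y : M))
  have e1 := represents_scalarCurvature g hV hVy ⟨y, hy⟩
  have e2 := represents_scalarCurvature g hV hVx ⟨y, hy⟩
  have e3 := represents_scalarCurvature g hU hUx y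
  rw [(isFrameChange_coord hV g hVy hVx).scal_eq (isLeviCivita_christoffelOn g hV hVy)
    (isLeviCivita_christoffelOn g hV hVx) (gramOn_mul_inv g hVy) (gramOn_mul_inv g hVx), ← e2]
    at e1
  exact e1.trans e3

theorem gradInner_eq {f h : M → ℝ} (hf : ContMDiff (𝓡∂ n) 𝓘(ℝ, ℝ) ∞ f)
    (hh : ContMDiff (𝓡∂ n) 𝓘(ℝ, ℝ) ∞ h) (hU : IsOpen U)
    (hUx : U ⊆ (chartAt (EuclideanHalfSpace n) x).source) (y : U) :
    g.gradInner f h y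
      = AlgRiem.gradInner (coordDeriv hU hUx) (gramOn g hUx)⁻¹ (mk f hf.contMDiffOn)
        (mk h hh.contMDiffOn) y := by
  have hV : IsOpen (U ∩ (chartAt (EuclideanHalfSpace n) (y : M)).source) :=
    hU.inter (chartAt (EuclideanHalfSpace n) (y : M)).open_source
  have hVx : U ∩ (chartAt (EuclideanHalfSpace n) (y : M)).source ⊆
      (chartAt (EuclideanHalfSpace n) x).source := fun z hz => hUx hz.1
  have hVy : U ∩ (chartAt (EuclideanHalfSpace n) (y : M)).source ⊆ _ := inter_subset_right
  have hy := And.intro y.2 (mem_chart_source (EuclideanHalfSpace n) (y : M))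
  have e1 := (represents_mk hVy hf.contMDiffOn).gradInner g hV hVy
    (represents_mk hVy hh.contMDiffOn) ⟨y, hy⟩
  have e2 := (represents_mk hVx hf.contMDiffOn).gradInner g hV hVx
    (represents_mk hVx hh.contMDiffOn) ⟨y, hy⟩
  have e3 := (represents_mk hUx hf.contMDiffOn).gradInner g hU hUx
    (represents_mk hUx hh.contMDiffOn) y
  rw [(isFrameChange_coord hV g hVy hVx).gradInner_eq (gramOn_mul_inv g hVy)
    (gramOn_mul_inv g hVx), ← e2] at e1
  exact e1.trans e3

/-- The Hessian as a bilinear form determines its components in the chart at the point. -/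
theorem coord_hess_eq {f : M → ℝ} {c : ℝ} {y : M}
    (h : ∀ v w : TangentSpace (𝓡∂ n) y, g.hessian f y v w = c * g.inner y v w) (i j : Fin n) :
    Coord.hess (range (𝓡∂ n)) (g.gram (chartAt (EuclideanHalfSpace n) y))
      (f ∘ (extChartAt (𝓡∂ n) y).symm) i j (extChartAt (𝓡∂ n) y y)
      = c * g.gram (chartAt (EuclideanHalfSpace n) y) (extChartAt (𝓡∂ n) y y) i j := by
  have hU := (chartAt (EuclideanHalfSpace n) y).open_source
  have hUy := Subset.refl (chartAt (EuclideanHalfSpace n) y).source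
  have hy := mem_chart_source (EuclideanHalfSpace n) y
  have e : ∀ i k, RiemMetric.coordComponent y (coordFrame n y i y) k = if k = i then 1 else 0 := by
    intro i k
    rw [← coordDeriv_coordFun hU hUy i k ⟨y, hy⟩, coordDeriv_apply hU hUy,
      mfderiv_extChartAt_apply hU hUy]
    rfl
  have h1 := h (coordFrame n y i y) (coordFrame n y j y)
  have h2 := represents_gram g hUy i j ⟨y, hy⟩
  rw [RiemMetric.hessian] at h1
  simp only [e, mul_ite, mul_one, mul_zero, Finset.sum_ite_eq', Finset.mem_univ, if_true] at h1
  refine h1.trans ?_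
  rw [gramOn_apply] at h2
  rw [← h2]

/-- The equation is tensorial: it is read off in the chart at `y` and multiplied by the Jacobian on
both sides. Only its validity at the single point `y` enters. -/
theorem hess_eq {f ψ : M → ℝ} (hf : ContMDiff (𝓡∂ n) 𝓘(ℝ, ℝ) ∞ f) (hU : IsOpen U)
    (hUx : U ⊆ (chartAt (EuclideanHalfSpace n) x).source) (y : U)
    (h : ∀ v w : TangentSpace (𝓡∂ n) (y : M), g.hessian f y v w = ψ y * g.inner (y : M) v w)
    (i j : Fin n) :
    AlgRiem.hess (coordDeriv hU hUx) (christoffelOn g hU hUx) (mk f hf.contMDiffOn) i j y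
      = ψ y * gramOn g hUx i j y := by
  have hV : IsOpen (U ∩ (chartAt (EuclideanHalfSpace n) (y : M)).source) :=
    hU.inter (chartAt (EuclideanHalfSpace n) (y : M)).open_source
  have hVx : U ∩ (chartAt (EuclideanHalfSpace n) (y : M)).source ⊆
      (chartAt (EuclideanHalfSpace n) x).source := fun z hz => hUx hz.1
  have hVy : U ∩ (chartAt (EuclideanHalfSpace n) (y : M)).source ⊆ _ := inter_subset_right
  have hy := And.intro y.2 (mem_chart_source (EuclideanHalfSpace n) (y : M))
  have hc := isFrameChange_coord hV g hVx hVy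
  have e1 : ∀ i j, AlgRiem.hess (coordDeriv hV hVy) (christoffelOn g hV hVy)
      (mk f hf.contMDiffOn) i j ⟨y, hy⟩ = ψ y * gramOn g hVy i j ⟨y, hy⟩ := by
    intro i j
    rw [← (represents_mk hVy hf.contMDiffOn).hess g hV hVy i j ⟨y, hy⟩,
      ← represents_gram g hVy i j ⟨y, hy⟩]
    exact coord_hess_eq h i j
  have e2 := (represents_mk hVx hf.contMDiffOn).hess g hV hVx i j ⟨y, hy⟩
  have e3 := (represents_mk hUx hf.contMDiffOn).hess g hU hUx i j y
  rw [← e3]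
  refine Eq.trans e2 ?_
  have e4 := congrFun (congrFun (hc.hess_eq (isLeviCivita_christoffelOn g hV hVx)
    (isLeviCivita_christoffelOn g hV hVy) (gramOn_mul_inv g hVy) (mk f hf.contMDiffOn)) i) j
  have e5 : gramOn g hUx i j y = gramOn g hVx i j ⟨y, hy⟩ := rfl
  have e6 := congrFun (congrFun hc.metric_eq i) j
  rw [Matrix.of_apply] at e4
  rw [e4, e5, e6]
  simp only [Matrix.mul_apply, Matrix.transpose_apply, Matrix.of_apply, smoothOn.sum_apply,
    smoothOn.mul_apply, Finset.mul_sum, Finset.sum_mul, e1]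
  exact Finset.sum_congr rfl fun i _ => Finset.sum_congr rfl fun j _ => by ring

end Represent

/-! ### Gradients, the scalar curvature identity and curves tangent to the boundary -/

section Global

open Set Filter Topology Bundle smoothOn

variable {n : ℕ} [NeZero n] {M : Type*} [TopologicalSpace M]
  [ChartedSpace (EuclideanHalfSpace n) M] [IsManifold (𝓡∂ n) ∞ M] {U : Set M} {x : M}
  {g : RiemMetric n M} {f h ψ : M → ℝ}

theorem contMDiff_of_forall_smoothOn {F : M → ℝ}
    (hF : ∀ x : M, ∃ a : smoothOn n (chartAt (EuclideanHalfSpace n) x).source,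
      ∀ y : (chartAt (EuclideanHalfSpace n) x).source, F y = a y) :
    ContMDiff (𝓡∂ n) 𝓘(ℝ, ℝ) ∞ F := by
  intro x
  obtain ⟨a, ha⟩ := hF x
  refine ((contMDiffOn_toFun a).congr fun y hy => ?_).contMDiffAt
    ((chartAt (EuclideanHalfSpace n) x).open_source.mem_nhds (mem_chart_source _ x))
  rw [ha ⟨y, hy⟩, toFun_apply a ⟨y, hy⟩]

theorem contMDiff_scalarCurvature (g : RiemMetric n M) :
    ContMDiff (𝓡∂ n) 𝓘(ℝ, ℝ) ∞ g.scalarCurvature :=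
  contMDiff_of_forall_smoothOn fun x =>
    ⟨_, scalarCurvature_eq (chartAt (EuclideanHalfSpace n) x).open_source Subset.rfl⟩

theorem contMDiff_gradInner (g : RiemMetric n M) (hf : ContMDiff (𝓡∂ n) 𝓘(ℝ, ℝ) ∞ f)
    (hh : ContMDiff (𝓡∂ n) 𝓘(ℝ, ℝ) ∞ h) : ContMDiff (𝓡∂ n) 𝓘(ℝ, ℝ) ∞ (g.gradInner f h) :=
  contMDiff_of_forall_smoothOn fun x =>
    ⟨_, gradInner_eq hf hh (chartAt (EuclideanHalfSpace n) x).open_source Subset.rfl⟩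

theorem mk_gradInner (hf : ContMDiff (𝓡∂ n) 𝓘(ℝ, ℝ) ∞ f) (hh : ContMDiff (𝓡∂ n) 𝓘(ℝ, ℝ) ∞ h)
    (hU : IsOpen U) (hUx : U ⊆ (chartAt (EuclideanHalfSpace n) x).source) :
    mk (g.gradInner f h) (contMDiff_gradInner g hf hh).contMDiffOn
      = AlgRiem.gradInner (coordDeriv hU hUx) (gramOn g hUx)⁻¹ (mk f hf.contMDiffOn)
        (mk h hh.contMDiffOn) := by
  ext y
  exact gradInner_eq hf hh hU hUx y

theorem mk_scalarCurvature (hU : IsOpen U)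
    (hUx : U ⊆ (chartAt (EuclideanHalfSpace n) x).source) :
    mk g.scalarCurvature (contMDiff_scalarCurvature g).contMDiffOn
      = AlgRiem.scal (coordDeriv hU hUx) (gramOn g hUx)⁻¹ (christoffelOn g hU hUx) := by
  ext y
  exact scalarCurvature_eq hU hUx y

/-- The components of the gradient at a point of the chart at `x`. -/
def gradOn (g : RiemMetric n M) (hU : IsOpen U)
    (hUx : U ⊆ (chartAt (EuclideanHalfSpace n) x).source)
    (a : smoothOn n U) : Fin n → smoothOn n U :=
  AlgRiem.grad (coordDeriv hU hUx) (gramOn g hUx)⁻¹ a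

theorem coordDeriv_eq_sum_gradOn (hU : IsOpen U)
    (hUx : U ⊆ (chartAt (EuclideanHalfSpace n) x).source) (a : smoothOn n U) (i : Fin n) (y : U) :
    coordDeriv hU hUx i a y = ∑ j, gramOn g hUx i j y * gradOn g hU hUx a j y := by
  have := congrFun (AlgRiem.mulVec_grad (d := coordDeriv hU hUx) (gramOn_mul_inv g hUx) a) i
  rw [← this, Matrix.mulVec, dotProduct, smoothOn.sum_apply]
  rfl

theorem gradInner_eq_sum_gradOn (hf : ContMDiff (𝓡∂ n) 𝓘(ℝ, ℝ) ∞ f)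
    (hh : ContMDiff (𝓡∂ n) 𝓘(ℝ, ℝ) ∞ h) (hU : IsOpen U)
    (hUx : U ⊆ (chartAt (EuclideanHalfSpace n) x).source) (y : U) :
    g.gradInner f h y = ∑ k, gradOn g hU hUx (mk f hf.contMDiffOn) k y
      * coordDeriv hU hUx k (mk h hh.contMDiffOn) y := by
  rw [gradInner_eq hf hh hU hUx, AlgRiem.gradInner_eq_sum_grad (gramOn_transpose g hUx)
    (gramOn_mul_inv g hUx), smoothOn.sum_apply]
  rfl

theorem gradInner_self_eq (hf : ContMDiff (𝓡∂ n) 𝓘(ℝ, ℝ) ∞ f) (hU : IsOpen U)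
    (hUx : U ⊆ (chartAt (EuclideanHalfSpace n) x).source) (y : U) :
    g.gradInner f f y = dotProduct (fun k => gradOn g hU hUx (mk f hf.contMDiffOn) k y)
      (((gramOn g hUx).map (eval y)).mulVec
        fun k => gradOn g hU hUx (mk f hf.contMDiffOn) k y) := by
  rw [gradInner_eq_sum_gradOn hf hf hU hUx]
  refine Finset.sum_congr rfl fun k _ => ?_
  rw [coordDeriv_eq_sum_gradOn (g := g)]
  rfl

theorem gradInner_self_nonneg (hf : ContMDiff (𝓡∂ n) 𝓘(ℝ, ℝ) ∞ f) (x : M) :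
    0 ≤ g.gradInner f f x := by
  have hU := (chartAt (EuclideanHalfSpace n) x).open_source
  rw [gradInner_self_eq hf hU Subset.rfl ⟨x, mem_chart_source _ x⟩]
  by_cases hv : (fun k => gradOn g hU Subset.rfl (mk f hf.contMDiffOn) k
    ⟨x, mem_chart_source _ x⟩) = 0
  · rw [hv, zero_dotProduct]
  · exact (dotProduct_gram_pos g Subset.rfl _ hv).le

theorem coordDeriv_eq_zero (hf : ContMDiff (𝓡∂ n) 𝓘(ℝ, ℝ) ∞ f) (hU : IsOpen U)
    (hUx : U ⊆ (chartAt (EuclideanHalfSpace n) x).source) (y : U)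
    (h0 : g.gradInner f f y = 0) (i : Fin n) :
    coordDeriv hU hUx i (mk f hf.contMDiffOn) y = 0 := by
  rw [gradInner_self_eq hf hU hUx] at h0
  have hv : (fun k => gradOn g hU hUx (mk f hf.contMDiffOn) k y) = 0 := by
    by_contra hv
    exact (dotProduct_gram_pos g hUx y hv).ne' h0
  rw [coordDeriv_eq_sum_gradOn (g := g)]
  exact Finset.sum_eq_zero fun j _ => by rw [show gradOn g hU hUx _ j y = 0 from congrFun hv j,
    mul_zero]

/-- If the gradient of `f` vanishes near a point where `∇²f = ψ g`, then `ψ = 0` there. -/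
theorem eq_zero_of_gradInner_self_eventuallyEq_zero (hf : ContMDiff (𝓡∂ n) 𝓘(ℝ, ℝ) ∞ f)
    (hess : ∀ v w : TangentSpace (𝓡∂ n) x, g.hessian f x v w = ψ x * g.inner x v w)
    (h0 : ∀ᶠ y in 𝓝 x, g.gradInner f f y = 0) : ψ x = 0 := by
  obtain ⟨V, hV, hVo, hxV⟩ := eventually_nhds_iff.1 h0
  have hU : IsOpen (V ∩ (chartAt (EuclideanHalfSpace n) x).source) :=
    hVo.inter (chartAt (EuclideanHalfSpace n) x).open_source
  have hUx : V ∩ (chartAt (EuclideanHalfSpace n) x).source ⊆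
    (chartAt (EuclideanHalfSpace n) x).source := inter_subset_right
  have hx : x ∈ V ∩ (chartAt (EuclideanHalfSpace n) x).source := ⟨hxV, mem_chart_source _ x⟩
  have hd : ∀ i, coordDeriv hU hUx i (mk f hf.contMDiffOn) = 0 := by
    intro i
    ext y
    exact coordDeriv_eq_zero hf hU hUx y (hV _ y.2.1) i
  -- One diagonal component suffices, because `g₀₀ > 0`.
  have e := hess_eq hf hU hUx ⟨x, hx⟩ hess 0 0
  rw [AlgRiem.hess] at e
  simp only [hd, map_zero, mul_zero, Finset.sum_const_zero, sub_zero, smoothOn.zero_apply] at e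
  rcases mul_eq_zero.1 e.symm with e | e
  · exact e
  · have hp := dotProduct_gram_pos g hUx ⟨x, hx⟩ (v := Pi.single 0 1)
      (fun h => one_ne_zero (α := ℝ) (by simpa using congrFun h 0))
    rw [single_one_dotProduct, Matrix.mulVec_single_one, Matrix.col_apply, Matrix.map_apply,
      eval_apply, e] at hp
    exact absurd hp (lt_irrefl _)

/-- If `∇²f = ψ g` at `x`, then `⟨∇f, ∇|∇f|²⟩ = 2 ψ |∇f|²` there. -/
theorem gradInner_gradInner_self (hf : ContMDiff (𝓡∂ n) 𝓘(ℝ, ℝ) ∞ f)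
    (hess : ∀ v w : TangentSpace (𝓡∂ n) x, g.hessian f x v w = ψ x * g.inner x v w) :
    g.gradInner f (g.gradInner f f) x = 2 * ψ x * g.gradInner f f x := by
  have hU := (chartAt (EuclideanHalfSpace n) x).open_source
  have hUx := Subset.refl (chartAt (EuclideanHalfSpace n) x).source
  have hx := mem_chart_source (EuclideanHalfSpace n) x
  rw [gradInner_eq_sum_gradOn hf (contMDiff_gradInner g hf hf) hU hUx ⟨x, hx⟩,
    gradInner_eq_sum_gradOn hf hf hU hUx ⟨x, hx⟩, Finset.mul_sum]
  refine Finset.sum_congr rfl fun k _ => ?_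
  rw [mk_gradInner hf hf hU hUx, (isLeviCivita_christoffelOn g hU hUx).deriv_gradInner_self
    (gramOn_mul_inv g hUx), coordDeriv_eq_sum_gradOn (g := g)]
  have e := hess_eq hf hU hUx ⟨x, hx⟩ hess k
  have two : ((2 : smoothOn n (chartAt (EuclideanHalfSpace n) x).source)) ⟨x, hx⟩ = (2 : ℝ) := rfl
  simp only [smoothOn.mul_apply, smoothOn.sum_apply, e, two, Finset.mul_sum]
  refine Finset.sum_congr rfl fun j _ => ?_
  rw [gradOn]; ring

/-- If `∇²f = ψ g`, then the derivative of the scalar curvature along `∇f` is determined by `ψ`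
and its derivatives along `∇f`. -/
theorem gradInner_scalarCurvature (hf : ContMDiff (𝓡∂ n) 𝓘(ℝ, ℝ) ∞ f)
    (hψ : ContMDiff (𝓡∂ n) 𝓘(ℝ, ℝ) ∞ ψ)
    (hess : ∀ (x : M) (v w : TangentSpace (𝓡∂ n) x),
      g.hessian f x v w = ψ x * g.inner x v w) (x : M) :
    g.gradInner f f x * g.gradInner f g.scalarCurvature x
      + 2 * ψ x * g.gradInner f f x * g.scalarCurvature x
      + 2 * ((n : ℝ) - 1) * (g.gradInner f (g.gradInner f ψ) x
        + ((n : ℝ) - 2) * ψ x * g.gradInner f ψ x) = 0 := by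
  have hU := (chartAt (EuclideanHalfSpace n) x).open_source
  have hUx := Subset.refl (chartAt (EuclideanHalfSpace n) x).source
  have hx := mem_chart_source (EuclideanHalfSpace n) x
  have e := (isLeviCivita_christoffelOn g hU hUx).gradInner_scal (f := mk f hf.contMDiffOn)
    (ψ := mk ψ hψ.contMDiffOn) (gramOn_mul_inv g hUx) (fun i j => by
      ext y
      rw [hess_eq hf hU hUx y (hess y)]; rfl)
  rw [← mk_scalarCurvature hU hUx, ← mk_gradInner hf hf hU hUx, ← mk_gradInner hf hψ hU hUx,
    ← mk_gradInner hf (contMDiff_scalarCurvature g) hU hUx,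
    ← mk_gradInner hf (contMDiff_gradInner g hf hψ) hU hUx, Fintype.card_fin] at e
  exact congrArg (eval ⟨x, hx⟩) e

/-- The entry equals `v · Gv` for `v = G⁻¹eᵢ`, which is nonzero. -/
theorem inv_gram_pos (hUx : U ⊆ (chartAt (EuclideanHalfSpace n) x).source) (y : U) (i : Fin n) :
    0 < (gramOn g hUx)⁻¹ i i y := by
  have h1 : (gramOn g hUx).map (eval y) * ((gramOn g hUx)⁻¹).map (eval y) = 1 := by
    rw [← Matrix.map_mul, gramOn_mul_inv, Matrix.map_one _ (map_zero _) (map_one _)]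
  set A := (gramOn g hUx).map (eval y)
  set B := ((gramOn g hUx)⁻¹).map (eval y)
  have h2 : A.mulVec (B.mulVec (Pi.single i 1)) = Pi.single i 1 := by
    rw [Matrix.mulVec_mulVec, h1, Matrix.one_mulVec]
  have hv : B.mulVec (Pi.single i 1) ≠ 0 := by
    intro h
    rw [h, Matrix.mulVec_zero] at h2
    exact one_ne_zero (α := ℝ) (by simpa using (congrFun h2 i).symm)
  have h3 := dotProduct_gram_pos g hUx y hv
  rw [h2, dotProduct_single_one, Matrix.mulVec_single_one, Matrix.col_apply] at h3
  exact h3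

/-- At boundary points where the normal derivative of `f` vanishes, the gradient of `f` is tangent
to the boundary. -/
theorem gradOn_zero_of_normalDeriv (hf : ContMDiff (𝓡∂ n) 𝓘(ℝ, ℝ) ∞ f)
    (h0 : g.normalDeriv f x = 0) :
    gradOn g (chartAt (EuclideanHalfSpace n) x).open_source Subset.rfl (mk f hf.contMDiffOn) 0
      ⟨x, mem_chart_source _ x⟩ = 0 := by
  have hU := (chartAt (EuclideanHalfSpace n) x).open_source
  have hUx := Subset.refl (chartAt (EuclideanHalfSpace n) x).source
  have hx := mem_chart_source (EuclideanHalfSpace n) x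
  have e1 := fun i => (represents_mk hUx hf.contMDiffOn).partialDeriv hU hUx i ⟨x, hx⟩
  have e2 := fun i j => represents_gram_inv g hUx i j ⟨x, hx⟩
  have hs := AlgRiem.symm_apply (AlgRiem.inv_symm (gramOn_transpose g hUx)
    (gramOn_mul_inv g hUx))
  have hpos := Real.sqrt_pos.2 (inv_gram_pos (g := g) hUx ⟨x, hx⟩ 0)
  simp only [RiemMetric.normalDeriv, Coord.normalDeriv, Coord.outwardNormal, e1, e2] at h0
  -- The component of the gradient transverse to the boundary is `-√g⁰⁰ ∂f/∂ν`.
  have e3 : gradOn g hU hUx (mk f hf.contMDiffOn) 0 ⟨x, hx⟩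
      = -Real.sqrt ((gramOn g hUx)⁻¹ 0 0 ⟨x, hx⟩) * ∑ i, -(gramOn g hUx)⁻¹ i 0 ⟨x, hx⟩
        / Real.sqrt ((gramOn g hUx)⁻¹ 0 0 ⟨x, hx⟩)
        * coordDeriv hU hUx i (mk f hf.contMDiffOn) ⟨x, hx⟩ := by
    rw [gradOn, AlgRiem.grad, Matrix.mulVec, dotProduct, smoothOn.sum_apply, Finset.mul_sum]
    refine Finset.sum_congr rfl fun i _ => ?_
    rw [smoothOn.mul_apply, hs 0 i]
    field_simp
  rw [e3, h0, mul_zero]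

/-- Curves in the direction of the gradient of `f`, when it is tangent to the boundary. -/
theorem exists_curve_gradInner (hf : ContMDiff (𝓡∂ n) 𝓘(ℝ, ℝ) ∞ f)
    (hb : (𝓡∂ n).IsBoundaryPoint x → g.normalDeriv f x = 0) :
    ∃ γ : ℝ → M, γ 0 = x ∧ ∀ h : M → ℝ, ContMDiff (𝓡∂ n) 𝓘(ℝ, ℝ) ∞ h →
      HasDerivAt (h ∘ γ) (g.gradInner f h x) 0 := by
  have hU := (chartAt (EuclideanHalfSpace n) x).open_source
  have hUx := Subset.refl (chartAt (EuclideanHalfSpace n) x).source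
  have hx := mem_chart_source (EuclideanHalfSpace n) x
  set X : EuclideanSpace ℝ (Fin n) := WithLp.toLp 2 fun i =>
    gradOn g hU hUx (mk f hf.contMDiffOn) i ⟨x, hx⟩ with hX
  set c : ℝ → EuclideanSpace ℝ (Fin n) := fun t => extChartAt (𝓡∂ n) x x + t • X with hc
  have hc0 : c 0 = extChartAt (𝓡∂ n) x x := by simp [hc]
  have hcd : HasDerivAt c X 0 := by
    have := ((hasDerivAt_id (0 : ℝ)).smul_const X).const_add (extChartAt (𝓡∂ n) x x)
    rwa [one_smul] at this
  -- The curve is a straight line in the chart. At an interior point it stays in the half-space for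
  -- small `t`; at a boundary point `X 0 = 0` keeps it in the hyperplane `y 0 = 0` for both signs of
  -- `t`, so the derivative obtained is two-sided.
  have hmem : ∀ᶠ t in 𝓝 (0 : ℝ), c t ∈ range (𝓡∂ n) := by
    rcases (𝓡∂ n).isInteriorPoint_or_isBoundaryPoint x with hi | hi
    · refine hcd.continuousAt.preimage_mem_nhds ?_
      rw [hc0]
      exact range_mem_nhds_isInteriorPoint hi
    · have h0 : X 0 = 0 := gradOn_zero_of_normalDeriv hf (hb hi)
      have h1 : extChartAt (𝓡∂ n) x x ∈ frontier (range (𝓡∂ n)) := hi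
      rw [frontier_range_modelWithCornersEuclideanHalfSpace] at h1
      refine Eventually.of_forall fun t => ?_
      rw [range_modelWithCornersEuclideanHalfSpace]
      have h2 : extChartAt (𝓡∂ n) x x 0 = 0 := h1.symm
      change 0 ≤ extChartAt (𝓡∂ n) x x 0 + t * X 0
      rw [h0, h2]; simp
  refine ⟨(extChartAt (𝓡∂ n) x).symm ∘ c, ?_, fun h hh => ?_⟩
  · rw [Function.comp_apply, hc0, extChartAt_to_inv]
  · have hr := represents_mk hUx hh.contMDiffOn
    have hd := (hr.differentiableWithinAt hU hUx ⟨x, hx⟩).hasFDerivWithinAt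
    rw [← hc0] at hd
    have := hd.comp_hasDerivAt (0 : ℝ) hcd hmem
    convert! this using 1
    rw [gradInner_eq_sum_gradOn hf hh hU hUx ⟨x, hx⟩, eq_sum_single X, map_sum]
    refine Finset.sum_congr rfl fun i _ => ?_
    rw [map_smul, hc0, smul_eq_mul, ← hr.partialDeriv hU hUx i ⟨x, hx⟩]
    rfl

end Global

/-! ### Maximum principles and the rigidity of solitons -/

section Soliton

open Set Filter Topology

variable {n : ℕ} [NeZero n] {M : Type*} [TopologicalSpace M]
  [ChartedSpace (EuclideanHalfSpace n) M] [IsManifold (𝓡∂ n) ∞ M]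
  {g : RiemMetric n M} {f φ ψ : M → ℝ} {m lam : ℝ}

/-- A function with `∇²f = ψ g` and `⟨∇f, ∇φ⟩ = -m ψ`, `m ≠ 0`, has vanishing gradient. -/
theorem gradInner_self_eq_zero_of_gradInner_eq [CompactSpace M]
    (hf : ContMDiff (𝓡∂ n) 𝓘(ℝ, ℝ) ∞ f) (hφ : ContMDiff (𝓡∂ n) 𝓘(ℝ, ℝ) ∞ φ) (hm : m ≠ 0)
    (hess : ∀ (x : M) (v w : TangentSpace (𝓡∂ n) x), g.hessian f x v w = ψ x * g.inner x v w)
    (hfφ : ∀ x, g.gradInner f φ x = -(m * ψ x))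
    (hb : ∀ x : M, (𝓡∂ n).IsBoundaryPoint x → g.normalDeriv f x = 0) (x : M) :
    g.gradInner f f x = 0 := by
  have hw := contMDiff_gradInner g hf hf
  -- The factor `exp(2φ/m)` cancels the term `2ψw` in `w'`; the factor `exp f` then leaves the
  -- strict term `w²`.
  let P : M → ℝ := fun y => g.gradInner f f y * Real.exp (2 / m * φ y + f y)
  have hP : Continuous P := hw.continuous.mul
    (Real.continuous_exp.comp ((hφ.continuous.const_mul _).add hf.continuous))
  obtain ⟨y, -, hy⟩ := isCompact_univ.exists_isMaxOn ⟨x, mem_univ x⟩ hP.continuousOn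
  obtain ⟨γ, h0, hγ⟩ := exists_curve_gradInner hf (hb y)
  have hd : HasDerivAt (P ∘ γ) _ 0 := (hγ _ hw).mul (((hγ φ hφ).const_mul (2 / m)).add (hγ f hf)).exp
  have hmax : IsLocalMax (P ∘ γ) 0 := Eventually.of_forall fun t => by
    rw [Function.comp_apply, Function.comp_apply, h0]
    exact hy (mem_univ (γ t))
  have e := hmax.hasDerivAt_eq_zero hd
  rw [gradInner_gradInner_self hf (hess y), hfφ] at e
  simp only [Function.comp_apply, Pi.add_apply, h0] at e
  have hy0 : g.gradInner f f y = 0 := by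
    have e' : g.gradInner f f y ^ 2 * Real.exp (2 / m * φ y + f y) = 0 := by
      rw [← e]; field_simp; ring
    simpa [Real.exp_ne_zero] using e'
  have h1 : P x ≤ P y := hy (mem_univ x)
  simp only [P, hy0, zero_mul] at h1
  exact le_antisymm (nonpos_of_mul_nonpos_left h1 (Real.exp_pos _)) (gradInner_self_nonneg hf x)

/-- Suppose that `∇²f = ψ g`. If the derivative of `Q` along `∇f` is nowhere equal to
`-(N ψ + σ |∇f|²) Q` on `{∇f ≠ 0, Q > 0}`, then `Q ≤ 0` on `{∇f ≠ 0}`. -/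
theorem nonpos_of_gradInner_add_ne_zero [CompactSpace M] {N : ℕ} (hN : N ≠ 0)
    (hf : ContMDiff (𝓡∂ n) 𝓘(ℝ, ℝ) ∞ f)
    (hess : ∀ (x : M) (v w : TangentSpace (𝓡∂ n) x), g.hessian f x v w = ψ x * g.inner x v w)
    (hb : ∀ x : M, (𝓡∂ n).IsBoundaryPoint x → g.normalDeriv f x = 0)
    {Q : M → ℝ} (hQ : ContMDiff (𝓡∂ n) 𝓘(ℝ, ℝ) ∞ Q) {σ : ℝ}
    (hQf : ∀ x, 0 < g.gradInner f f x → 0 < Q x →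
      g.gradInner f Q x + N * ψ x * Q x + σ * g.gradInner f f x * Q x ≠ 0)
    {x : M} (hx : 0 < g.gradInner f f x) : Q x ≤ 0 := by
  have hw := contMDiff_gradInner g hf hf
  by_contra! hQx
  -- Along `∇f` the derivative of `√w` is `ψ√w`, so the derivative of `P` is `√w^N exp(σf)` times
  -- the expression that `hQf` makes nonzero. A positive maximum of `P` lies in `{w > 0, Q > 0}`,
  -- where the square root is differentiable.
  let P : M → ℝ := fun y => Real.sqrt (g.gradInner f f y) ^ N * Q y * Real.exp (σ * f y)
  have hP : Continuous P := ((hw.continuous.sqrt.pow N).mul hQ.continuous).mul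
    (Real.continuous_exp.comp (hf.continuous.const_mul _))
  obtain ⟨y, -, hy⟩ := isCompact_univ.exists_isMaxOn ⟨x, mem_univ x⟩ hP.continuousOn
  have hPx : 0 < P x := by have := Real.sqrt_pos.2 hx; positivity
  have hPy : 0 < P y := hPx.trans_le (hy (mem_univ x))
  have hy1 : 0 < Real.sqrt (g.gradInner f f y) := by
    refine (Real.sqrt_nonneg _).lt_of_ne' fun h => hPy.ne' ?_
    simp only [P, h, zero_pow hN, zero_mul]
  have hwy := Real.sqrt_pos.1 hy1
  have hQy : 0 < Q y := by
    have := pos_of_mul_pos_left hPy (Real.exp_pos _).le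
    exact pos_of_mul_pos_right this (pow_pos hy1 N).le
  obtain ⟨γ, h0, hγ⟩ := exists_curve_gradInner hf (hb y)
  have hd : HasDerivAt (P ∘ γ) _ 0 :=
    (((((hγ _ hw).sqrt (by simpa [h0] using hwy.ne')).pow N)).mul (hγ Q hQ)).mul
      ((hγ f hf).const_mul σ).exp
  have hmax : IsLocalMax (P ∘ γ) 0 := Eventually.of_forall fun t => by
    rw [Function.comp_apply, Function.comp_apply, h0]
    exact hy (mem_univ (γ t))
  have e := hmax.hasDerivAt_eq_zero hd
  rw [gradInner_gradInner_self hf (hess y)] at e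
  simp only [Function.comp_apply, Pi.pow_apply, Pi.mul_apply, h0] at e
  refine hQf y hwy hQy ?_
  obtain ⟨k, rfl⟩ := Nat.exists_eq_succ_of_ne_zero hN
  set r := Real.sqrt (g.gradInner f f y) with hr
  have hr2 : g.gradInner f f y = r ^ 2 := (Real.sq_sqrt hwy.le).symm
  have hE := Real.exp_pos (σ * f y)
  have e' : r ^ (k + 1) * Real.exp (σ * f y) * (g.gradInner f Q y + (k + 1 : ℕ) * ψ y * Q y
      + σ * g.gradInner f f y * Q y) = 0 := by
    rw [← e, hr2]
    simp only [Nat.succ_eq_add_one, Nat.add_sub_cancel]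
    field_simp
    ring
  exact (mul_eq_zero.1 e').resolve_left (by positivity)

/-- A function on a compact manifold with `∇²f = (lam - R) g` and vanishing normal derivative:
the scalar curvature `R` is equal to `lam`. -/
theorem scalarCurvature_eq_of_hessian_eq [CompactSpace M] (hn : 3 ≤ n)
    (hf : ContMDiff (𝓡∂ n) 𝓘(ℝ, ℝ) ∞ f)
    (hess : ∀ (x : M) (v w : TangentSpace (𝓡∂ n) x),
      g.hessian f x v w = (lam - g.scalarCurvature x) * g.inner x v w)
    (hb : ∀ x : M, (𝓡∂ n).IsBoundaryPoint x → g.normalDeriv f x = 0) (x : M) :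
    g.scalarCurvature x = lam := by
  obtain ⟨N, rfl⟩ := Nat.exists_eq_add_of_le hn
  set ψ : M → ℝ := fun x => lam - g.scalarCurvature x with hψd
  have hR := contMDiff_scalarCurvature g
  have hψ : ContMDiff (𝓡∂ (3 + N)) 𝓘(ℝ, ℝ) ∞ ψ := contMDiff_const.sub hR
  have hw := contMDiff_gradInner g hf hf
  have hp := contMDiff_gradInner g hf hψ
  have hq := contMDiff_gradInner g hf hp
  set w := g.gradInner f f with hwd
  set p := g.gradInner f ψ with hpd
  -- Here `n = N + 3`, so the coefficients are `n - 1` and `λ/n`. The coefficient `-1/2` cancels the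
  -- term `wp`, and `λ/n` the term `λψw`; only a multiple of `ψ²w`, of definite sign, survives in
  -- `key`.
  let Q : M → ℝ := fun y => ((N : ℝ) + 2) * p y + (lam / ((N : ℝ) + 3) - ψ y / 2) * w y
  have hQ : ContMDiff (𝓡∂ (3 + N)) 𝓘(ℝ, ℝ) ∞ Q :=
    (contMDiff_const.mul hp).add ((contMDiff_const.sub (hψ.div_const 2)).mul hw)
  have key : ∀ y, g.gradInner f Q y + ((N + 1 : ℕ) : ℝ) * ψ y * Q y
      = -(((N : ℝ) + 1) / 2 * (ψ y ^ 2 * w y)) := by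
    intro y
    -- Linearity and the product rule for differentiation along `∇f` are taken from ordinary
    -- calculus on the curve, by uniqueness of derivatives.
    obtain ⟨γ, h0, hγ⟩ := exists_curve_gradInner hf (hb y)
    have e1 : g.gradInner f ψ y = -g.gradInner f g.scalarCurvature y :=
      (hγ ψ hψ).unique ((hγ _ hR).const_sub lam)
    have e2 := (hγ Q hQ).unique (((hγ p hp).const_mul ((N : ℝ) + 2)).add
      ((((hγ ψ hψ).div_const 2).const_sub (lam / ((N : ℝ) + 3))).mul (hγ w hw)))
    have e3 := gradInner_scalarCurvature hf hψ hess y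
    have e4 : g.gradInner f w y = 2 * ψ y * w y := gradInner_gradInner_self hf (hess y)
    simp only [Function.comp_apply, h0, e4] at e2
    have e5 : g.scalarCurvature y = lam - ψ y := by simp [hψd]
    have e6 : g.gradInner f g.scalarCurvature y = -p y := by rw [hpd, e1, neg_neg]
    rw [e6, e5] at e3
    change w y * -p y + 2 * ψ y * w y * (lam - ψ y) + 2 * (((3 + N : ℕ) : ℝ) - 1)
      * (g.gradInner f p y + (((3 + N : ℕ) : ℝ) - 2) * ψ y * p y) = 0 at e3
    change _ = _ * g.gradInner f p y + (-(p y / 2) * w y + _) at e2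
    have hN : (N : ℝ) + 3 ≠ 0 := by positivity
    obtain ⟨c, hc⟩ : ∃ c, lam = c * ((N : ℝ) + 3) := ⟨lam / (N + 3), by field_simp⟩
    have hc' : lam / ((N : ℝ) + 3) = c := by rw [hc]; field_simp
    rw [e2]
    simp only [Q, hc']
    rw [hc] at e3
    push_cast at e3 ⊢
    linear_combination e3 / 2
  have hQn : ∀ y, g.gradInner f (fun z => -Q z) y = -g.gradInner f Q y := by
    intro y
    obtain ⟨γ, h0, hγ⟩ := exists_curve_gradInner hf (hb y)
    exact (hγ _ hQ.neg).unique (hγ Q hQ).neg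
  have hQ0 : ∀ y, 0 < w y → Q y = 0 := by
    intro y hy
    -- By `key`, the expression to be nonzero is `-((n-2)/2)ψ²w - wQ < 0` for `Q` with `σ = -1`, and
    -- `((n-2)/2)ψ²w + w(-Q) > 0` for `-Q` with `σ = 1`. The exponential weight supplies strictness
    -- where `ψ = 0`.
    refine le_antisymm ?_ (neg_nonpos.1 ?_)
    · refine nonpos_of_gradInner_add_ne_zero N.succ_ne_zero hf hess hb hQ (σ := -1)
        (fun z hz hQz => ?_) hy
      rw [Nat.succ_eq_add_one, key]
      have : 0 ≤ ((N : ℝ) + 1) / 2 * (ψ z ^ 2 * w z) := by positivity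
      have : 0 < w z * Q z := mul_pos hz hQz
      change _ + -1 * w z * Q z ≠ 0
      nlinarith
    · refine nonpos_of_gradInner_add_ne_zero N.succ_ne_zero hf hess hb hQ.neg (σ := 1)
        (fun z hz hQz => ?_) hy
      have e := key z
      have : 0 ≤ ((N : ℝ) + 1) / 2 * (ψ z ^ 2 * w z) := by positivity
      have : 0 < w z * -Q z := mul_pos hz hQz
      change g.gradInner f (fun z => -Q z) z + _ * ψ z * -Q z + 1 * w z * -Q z ≠ 0
      rw [Nat.succ_eq_add_one, hQn]
      nlinarith
  have hψ0 : ∀ y, 0 < w y → ψ y = 0 := by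
    intro y hy
    obtain ⟨γ, h0, hγ⟩ := exists_curve_gradInner hf (hb y)
    have hev : ∀ᶠ t in 𝓝 (0 : ℝ), 0 < (w ∘ γ) t :=
      (hγ w hw).continuousAt.eventually_const_lt (by simpa [h0] using hy)
    -- `Q` vanishes on the open set `{w > 0}`, hence along the curve for small `t`.
    have hz : g.gradInner f Q y = 0 := (hγ Q hQ).unique
      ((hasDerivAt_const (0 : ℝ) (0 : ℝ)).congr_of_eventuallyEq (hev.mono fun t ht => hQ0 _ ht))
    have e := key y
    rw [hz, hQ0 y hy, mul_zero, add_zero, eq_comm, neg_eq_zero] at e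
    have hN : ((N : ℝ) + 1) / 2 ≠ 0 := by positivity
    simpa [hN, hy.ne'] using e
  have hψx : ψ x = 0 := by
    by_cases hx : x ∈ closure {y | 0 < w y}
    · exact closure_minimal hψ0 (isClosed_eq hψ.continuous continuous_const) hx
    · refine eq_zero_of_gradInner_self_eventuallyEq_zero hf (hess x) ?_
      filter_upwards [isClosed_closure.isOpen_compl.mem_nhds hx] with y hy
      exact le_antisymm (not_lt.1 fun h => hy (subset_closure h)) (gradInner_self_nonneg hf y)
  exact (sub_eq_zero.1 hψx).symm

theorem weightedScalarCurvature_eq_scalarCurvature {S : SmoothMetricMeasureSpace n M}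
    (hm : S.m = 0) (x : M) : S.weightedScalarCurvature x = S.metric.scalarCurvature x := by
  have h : S.phi ∘ (extChartAt (𝓡∂ n) x).symm = 0 := funext fun y => S.phi_eq_zero hm _
  have h1 : ∀ i, Coord.partialDeriv (range (𝓡∂ n)) i
      (0 : EuclideanSpace ℝ (Fin n) → ℝ) = 0 := by
    intro i; ext y; simp [Coord.partialDeriv]
  have hL : S.metric.laplacian S.phi x = 0 := by
    simp only [RiemMetric.laplacian, Coord.laplacian, Coord.hess, h, h1, Pi.zero_apply, mul_zero,
      Finset.sum_const_zero, sub_zero]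
  -- With `m = 0` the coefficient `(m + 1) / m` is a division by zero, whose value is `0`, so the
  -- gradient term drops out.
  rw [SmoothMetricMeasureSpace.weightedScalarCurvature, hL, hm]
  simp

end Soliton

end

theorem mainTheorem5 (n : ℕ) [NeZero n] (hn : 3 ≤ n)
    (M : Type*) [TopologicalSpace M] [T2Space M] [CompactSpace M]
    [ChartedSpace (EuclideanHalfSpace n) M] [IsManifold (𝓡∂ n) ∞ M]
    (S : SmoothMetricMeasureSpace n M) (f : M → ℝ) (lam : ℝ)
    (hS : S.IsGradientWeightedYamabeSoliton f lam)
    (hphi : ∀ x : M, (𝓡∂ n).IsBoundaryPoint x → S.metric.normalDeriv S.phi x = 0) :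
    ∀ x : M, S.weightedScalarCurvature x = lam := by
  intro x
  by_cases hm : S.m = 0
  · rw [weightedScalarCurvature_eq_scalarCurvature hm]
    refine scalarCurvature_eq_of_hessian_eq hn hS.contMDiff (fun x v w => ?_) hS.normalDeriv_eq x
    rw [hS.hessian_eq, weightedScalarCurvature_eq_scalarCurvature hm]
  · refine (sub_eq_zero.1 (eq_zero_of_gradInner_self_eventuallyEq_zero
      (ψ := fun x => lam - S.weightedScalarCurvature x) hS.contMDiff (hS.hessian_eq x)
      (Filter.Eventually.of_forall fun y => ?_))).symm
    exact gradInner_self_eq_zero_of_gradInner_eq hS.contMDiff S.contMDiff_phi hm hS.hessian_eq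
      (fun x => by rw [hS.gradInner_eq]; ring) hS.normalDeriv_eq y
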